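/- Let $G$ be a locally compact Hausdorff group with a fixed left Haar measure $\sigma$ and modular function $\Delta_G$ (so $\sigma(Ex)=\Delta_G(x)\sigma(E)$), let $H$ be a compact subgroup of $G$ with probability Haar measure $dh$, and let $\mu$ be the $G$-invariant Radon measure on the left coset space $G/H$ normalized by Weil's formula $$\int_{G/H}\Big(\int_H f(xh)\,dh\Big)d\mu(xH)=\int_G f\,d\sigma\qquad(f\in\mathcal C_c(G)).$$ For $\varphi,\psi\in\mathcal C_c(G/H)$ put $$\varphi*_{G/H}\psi(xH)=\int_{G/H}\varphi(yH)\,J\psi(y^{-1}xH)\,d\mu(yH),\quad J\psi(xH)=\int_H\psi(hxH)\,dh,\quad \varphi^{*}(xH)=\Delta_G(x^{-1})\int_H\overline{\varphi(h^{-1}x^{-1}H)}\,dh .$$ These operations have unique extensions to a bounded bilinear map $*_{G/H}$ and a bounded conjugate-linear map ${}^{*}$ on $L^1(G/H,\mu)$. Let $$A^1(G/H,\mu)=\{\varphi\in L^1(G/H,\mu): \varphi(h^{-1}\,\cdot)=\varphi\ \ \forall h\in H\}.$$ Let $M(G/H)$ be the space of regular complex Borel measures on $G/H$ with the total variation norm,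 and let $\mathcal M(G/H)=\{\lambda\in M(G/H):\lambda(hE)=\lambda(E)\text{ for all }h\in H\text{ and Borel }E\}$. For $\lambda,\lambda'\in M(G/H)$ there are unique measures $\lambda*_{G/H}\lambda',\ \lambda^{*}\in M(G/H)$ such that, for all $\psi\in\mathcal C_0(G/H)$, $$\int\psi\,d(\lambda*_{G/H}\lambda')=\int_{G/H}\int_{G/H}\int_H\psi(xhyH)\,dh\,d\lambda(xH)\,d\lambda'(yH),\qquad \int\psi\,d\lambda^{*}=\int_{G/H}\int_H\psi(h^{-1}x^{-1}H)\,dh\,d\overline{\lambda}(xH).$$ For $\varphi\in L^1(G/H,\mu)$ there is a unique $\mu_\varphi\in M(G/H)$ with $\int\psi\,d\mu_\varphi=\int\psi\varphi\,d\mu$ for all $\psi\in\mathcal C_0(G/H)$. Then $A^1(G/H,\mu)$ with the $L^1$-norm and $\mathcal M(G/H)$ with the total variation norm are Banach $*$-algebras (with isometric involution) under these operations, and $\varphi\mapsto\mu_\varphi$ is an isometric $*$-homomorphic embedding of $A^1(G/H,\mu)$ into $\mathcal M(G/H)$: it is an injective linear map of $A^1(G/H,\mu)$ into $\mathcal M(G/H)$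 with $$\|\mu_\varphi\|_{M(G/H)}=\|\varphi\|_{L^1(G/H,\mu)},\qquad \mu_{\varphi*_{G/H}\psi}=\mu_\varphi*_{G/H}\mu_\psi,\qquad \mu_{\varphi^{*}}=(\mu_\varphi)^{*}\qquad(\varphi,\psi\in A^1(G/H,\mu)).$$ -/

import Mathlib

open MeasureTheory Filter Topology
open scoped CompactlySupported ZeroAtInfty

noncomputable section

namespace CosetAlgebra

/-! ### The left coset space -/

section CosetSpace

variable {G : Type*} [Group G]

/-- The left coset space `G/H`. It is a type synonym of `G ⧸ H`, with the quotient topology and the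
left action of `G`, but equipped with its **Borel** σ-algebra (the measurable space structure
that Mathlib puts on `G ⧸ H` is the quotient σ-algebra, which need not be the Borel one). -/
def CosetSpace (H : Subgroup G) : Type _ := G ⧸ H

variable {H : Subgroup G}

instance instMulActionCosetSpace : MulAction G (CosetSpace H) :=
  inferInstanceAs (MulAction G (G ⧸ H))

instance instTopologicalSpaceCosetSpace [TopologicalSpace G] : TopologicalSpace (CosetSpace H) :=
  inferInstanceAs (TopologicalSpace (G ⧸ H))

instance instMeasurableSpaceCosetSpace [TopologicalSpace G] : MeasurableSpace (CosetSpace H) :=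
  borel (CosetSpace H)

instance instBorelSpaceCosetSpace [TopologicalSpace G] : BorelSpace (CosetSpace H) := ⟨rfl⟩

/-- The canonical map `q : G → G/H`, `x ↦ xH`. -/
def CosetSpace.mk (H : Subgroup G) (x : G) : CosetSpace H := (QuotientGroup.mk x : G ⧸ H)

/-- A representative `x` of a coset `xH`. It is only used in expressions whose value does not depend
on the representative chosen. -/
def CosetSpace.rep (x : CosetSpace H) : G := Quotient.out (show G ⧸ H from x)

theorem CosetSpace.mk_rep (x : CosetSpace H) : CosetSpace.mk H x.rep = x :=
  QuotientGroup.out_eq' (show G ⧸ H from x)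

end CosetSpace

/-! ### Regular complex Borel measures on a locally compact Hausdorff space -/

section ComplexMeasures

variable {X : Type*} [TopologicalSpace X] [MeasurableSpace X]

/-- `∫ f dκ` for a complex measure `κ` and a complex-valued function `f`. -/
def cIntegral (κ : ComplexMeasure X) (f : X → ℂ) : ℂ :=
  κ.integral f (ContinuousLinearMap.mul ℝ ℂ)

/-- The total variation norm `|κ|(X)`. -/
def tvNorm (κ : ComplexMeasure X) : ℝ := κ.variation.real Set.univ

/-- The conjugate complex measure, `E ↦ conj (κ E)`. -/
def conjMeasure (κ : ComplexMeasure X) : ComplexMeasure X :=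
  κ.mapRange (starRingEnd ℂ).toAddMonoidHom Complex.continuous_conj

/-- `M(X)`: the regular complex Borel measures, that is, those whose absolute value `|κ|` is a
regular Borel measure. -/
def regularMeasures (X : Type*) [TopologicalSpace X] [MeasurableSpace X] : Set (ComplexMeasure X) :=
  {κ | κ.variation.Regular}

/-- `κ ∈ M(X)` represents the functional `Γ` on `C₀(X)`: `∫ ψ dκ = Γ ψ` for all `ψ ∈ C₀(X)`. -/
def Represents (Γ : C₀(X, ℂ) → ℂ) (κ : ComplexMeasure X) : Prop :=
  κ ∈ regularMeasures X ∧ ∀ ψ : C₀(X, ℂ), cIntegral κ ψ = Γ ψ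

open Classical in
/-- The regular complex measure associated with a functional on `C₀(X)` by the Riesz-Markov
theorem (and `0` if there is none). -/
def rieszMeasure (Γ : C₀(X, ℂ) → ℂ) : ComplexMeasure X :=
  if h : ∃ κ, Represents Γ κ then h.choose else 0

/-- The functional `ψ ↦ ∫ ψ φ dμ`. -/
def densityFunctional (μ : Measure X) (φ : Lp ℂ 1 μ) (ψ : C₀(X, ℂ)) : ℂ :=
  ∫ x, ψ x * φ x ∂μ

/-- The complex measure `μ_φ` given by `∫ ψ dμ_φ = ∫ ψ φ dμ`. -/
def densityMeasure (μ : Measure X) (φ : Lp ℂ 1 μ) : ComplexMeasure X :=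
  rieszMeasure (densityFunctional μ φ)

end ComplexMeasures

/-! ### The structure on the coset space of a compact subgroup -/

section Coset

variable {G : Type*} [Group G] [TopologicalSpace G] [IsTopologicalGroup G] [LocallyCompactSpace G]
  [MeasurableSpace G] [BorelSpace G]

/-- The probability Haar measure `dh` of the compact group `H`. -/
def haarProb (H : Subgroup G) [CompactSpace H] : Measure H :=
  Measure.haarMeasure (⊤ : TopologicalSpace.PositiveCompacts H)

/-- The modular function `Δ_G` of `G`, in the convention `σ(E x) = Δ_G(x) σ(E)` for a left Haar
measure `σ`. (Mathlib's `modularCharacterFun x` is the factor of `E ↦ σ(E x⁻¹)`.) -/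
def modularFunction (x : G) : ℝ := (Measure.modularCharacterFun x⁻¹ : ℝ)

variable (H : Subgroup G) [CompactSpace H]

/-- `T_H f (xH) = ∫_H f(xh) dh`. -/
def cosetAverage (f : G → ℂ) (x : CosetSpace H) : ℂ :=
  ∫ h : H, f (x.rep * h) ∂(haarProb H)

/-- Weil's formula `∫_{G/H} T_H f dμ = ∫_G f dσ`, for all `f ∈ C_c(G)`. -/
def WeilFormula (σ : Measure G) (μ : Measure (CosetSpace H)) : Prop :=
  ∀ f : C_c(G, ℂ), ∫ x, cosetAverage H f x ∂μ = ∫ x, f x ∂σ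

/-- `J ψ (xH) = ∫_H ψ(hxH) dh`. -/
def leftAverage (ψ : CosetSpace H → ℂ) (x : CosetSpace H) : ℂ :=
  ∫ h : H, ψ ((h : G) • x) ∂(haarProb H)

/-- `(φ * ψ)(xH) = ∫_{G/H} φ(yH) Jψ(y⁻¹xH) dμ(yH)`. -/
def convFun (μ : Measure (CosetSpace H)) (φ ψ : CosetSpace H → ℂ) (x : CosetSpace H) : ℂ :=
  ∫ y, φ y * leftAverage H ψ (y.rep⁻¹ • x) ∂μ

/-- `φ^*(xH) = Δ_G(x⁻¹) ∫_H conj φ(h⁻¹x⁻¹H) dh`. -/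
def invFun (φ : CosetSpace H → ℂ) (x : CosetSpace H) : ℂ :=
  (modularFunction x.rep⁻¹ : ℂ) *
    ∫ h : H, starRingEnd ℂ (φ (CosetSpace.mk H ((h : G)⁻¹ * x.rep⁻¹))) ∂(haarProb H)

/-- `B` is a bounded bilinear map on `L¹(G/H, μ)` that extends the convolution of `C_c(G/H)`. -/
def IsConvExtension (μ : Measure (CosetSpace H))
    (B : Lp ℂ 1 μ →L[ℂ] Lp ℂ 1 μ →L[ℂ] Lp ℂ 1 μ) : Prop :=
  ∀ (φ ψ : C_c(CosetSpace H, ℂ)) (Φ Ψ : Lp ℂ 1 μ), Φ =ᵐ[μ] φ → Ψ =ᵐ[μ] ψ →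
    B Φ Ψ =ᵐ[μ] convFun H μ φ ψ

/-- `S` is a bounded conjugate-linear map on `L¹(G/H, μ)` that extends the involution of
`C_c(G/H)`. -/
def IsInvExtension (μ : Measure (CosetSpace H)) (S : Lp ℂ 1 μ →L⋆[ℂ] Lp ℂ 1 μ) : Prop :=
  ∀ (φ : C_c(CosetSpace H, ℂ)) (Φ : Lp ℂ 1 μ), Φ =ᵐ[μ] φ → S Φ =ᵐ[μ] invFun H φ

open Classical in
/-- The convolution of `L¹(G/H, μ)`: the extension of the convolution of `C_c(G/H)`. -/
def l1Conv (μ : Measure (CosetSpace H)) (Φ Ψ : Lp ℂ 1 μ) : Lp ℂ 1 μ :=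
  if h : ∃ B, IsConvExtension H μ B then h.choose Φ Ψ else 0

open Classical in
/-- The involution of `L¹(G/H, μ)`: the extension of the involution of `C_c(G/H)`. -/
def l1Inv (μ : Measure (CosetSpace H)) (Φ : Lp ℂ 1 μ) : Lp ℂ 1 μ :=
  if h : ∃ S, IsInvExtension H μ S then h.choose Φ else 0

/-- `A¹(G/H, μ)`: the `φ ∈ L¹(G/H, μ)` with `L_h φ = φ` for all `h ∈ H`, where
`L_h φ (xH) = φ(h⁻¹xH)`. -/
def A1 (μ : Measure (CosetSpace H)) : Set (Lp ℂ 1 μ) :=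
  {Φ | ∀ h ∈ H, (fun x => Φ (h⁻¹ • x)) =ᵐ[μ] Φ}

/-- The functional
`ψ ↦ ∫_{G/H} ∫_{G/H} (∫_H ψ(xhyH) dh) dκ(xH) dκ'(yH)`. -/
def convFunctional (κ κ' : ComplexMeasure (CosetSpace H)) (ψ : C₀(CosetSpace H, ℂ)) : ℂ :=
  cIntegral κ' fun y => cIntegral κ fun x =>
    ∫ h : H, ψ ((x.rep * (h : G)) • y) ∂(haarProb H)

/-- The functional `ψ ↦ ∫_{G/H} (∫_H ψ(h⁻¹x⁻¹H) dh) d(conj κ)(xH)`. -/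
def invFunctional (κ : ComplexMeasure (CosetSpace H)) (ψ : C₀(CosetSpace H, ℂ)) : ℂ :=
  cIntegral (conjMeasure κ) fun x =>
    ∫ h : H, ψ (CosetSpace.mk H ((h : G)⁻¹ * x.rep⁻¹)) ∂(haarProb H)

/-- The convolution of complex measures on `G/H`. -/
def measConv (κ κ' : ComplexMeasure (CosetSpace H)) : ComplexMeasure (CosetSpace H) :=
  rieszMeasure (convFunctional H κ κ')

/-- The involution of complex measures on `G/H`. -/
def measInv (κ : ComplexMeasure (CosetSpace H)) : ComplexMeasure (CosetSpace H) :=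
  rieszMeasure (invFunctional H κ)

/-- `𝓜(G/H)`: the regular complex measures `κ` with `κ(hE) = κ(E)` for all `h ∈ H` and all
Borel sets `E`. -/
def invariantMeasures : Set (ComplexMeasure (CosetSpace H)) :=
  {κ | κ ∈ regularMeasures (CosetSpace H) ∧
    ∀ h ∈ H, ∀ E : Set (CosetSpace H), MeasurableSet E → κ ((fun x => h • x) '' E) = κ E}

end Coset

/-! ### Banach `*`-algebras and their embeddings -/

/-- The subset `S` of the complex vector space `V` is a linear subspace, and with the norm, the
multiplication and the involution given by `nrm`, `mul`, `inv` it is a Banach `*`-algebra. -/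
structure IsBanachStarAlgebra {V : Type*} [AddCommGroup V] [Module ℂ V] (S : Set V) (nrm : V → ℝ)
    (mul : V → V → V) (inv : V → V) : Prop where
  zero_mem : 0 ∈ S
  add_mem : ∀ a ∈ S, ∀ b ∈ S, a + b ∈ S
  smul_mem : ∀ (c : ℂ), ∀ a ∈ S, c • a ∈ S
  mul_mem : ∀ a ∈ S, ∀ b ∈ S, mul a b ∈ S
  inv_mem : ∀ a ∈ S, inv a ∈ S
  norm_nonneg : ∀ a ∈ S, 0 ≤ nrm a
  norm_eq_zero : ∀ a ∈ S, nrm a = 0 ↔ a = 0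
  norm_add_le : ∀ a ∈ S, ∀ b ∈ S, nrm (a + b) ≤ nrm a + nrm b
  norm_smul : ∀ (c : ℂ), ∀ a ∈ S, nrm (c • a) = ‖c‖ * nrm a
  complete : ∀ u : ℕ → V, (∀ n, u n ∈ S) →
    (∀ ε > 0, ∃ N, ∀ m ≥ N, ∀ n ≥ N, nrm (u m - u n) < ε) →
    ∃ a ∈ S, Tendsto (fun n => nrm (u n - a)) atTop (𝓝 0)
  add_mul : ∀ a ∈ S, ∀ b ∈ S, ∀ c ∈ S, mul (a + b) c = mul a c + mul b c
  mul_add : ∀ a ∈ S, ∀ b ∈ S, ∀ c ∈ S, mul a (b + c) = mul a b + mul a c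
  smul_mul : ∀ (c : ℂ), ∀ a ∈ S, ∀ b ∈ S, mul (c • a) b = c • mul a b
  mul_smul : ∀ (c : ℂ), ∀ a ∈ S, ∀ b ∈ S, mul a (c • b) = c • mul a b
  mul_assoc : ∀ a ∈ S, ∀ b ∈ S, ∀ c ∈ S, mul (mul a b) c = mul a (mul b c)
  norm_mul_le : ∀ a ∈ S, ∀ b ∈ S, nrm (mul a b) ≤ nrm a * nrm b
  inv_add : ∀ a ∈ S, ∀ b ∈ S, inv (a + b) = inv a + inv b
  inv_smul : ∀ (c : ℂ), ∀ a ∈ S, inv (c • a) = starRingEnd ℂ c • inv a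
  inv_inv : ∀ a ∈ S, inv (inv a) = a
  inv_mul : ∀ a ∈ S, ∀ b ∈ S, inv (mul a b) = mul (inv b) (inv a)
  norm_inv : ∀ a ∈ S, nrm (inv a) = nrm a

/-- `F` restricts to an isometric `*`-homomorphic embedding of `S` into `S'`. -/
structure IsIsometricStarEmbedding {V W : Type*} [AddCommGroup V] [Module ℂ V] [AddCommGroup W]
    [Module ℂ W] (S : Set V) (nrm : V → ℝ) (mul : V → V → V) (inv : V → V)
    (S' : Set W) (nrm' : W → ℝ) (mul' : W → W → W) (inv' : W → W) (F : V → W) : Prop where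
  mapsTo : Set.MapsTo F S S'
  injOn : Set.InjOn F S
  map_add : ∀ a ∈ S, ∀ b ∈ S, F (a + b) = F a + F b
  map_smul : ∀ (c : ℂ), ∀ a ∈ S, F (c • a) = c • F a
  map_mul : ∀ a ∈ S, ∀ b ∈ S, F (mul a b) = mul' (F a) (F b)
  map_inv : ∀ a ∈ S, F (inv a) = inv' (F a)
  map_norm : ∀ a ∈ S, nrm' (F a) = nrm a

end CosetAlgebra

end

open CosetAlgebra

noncomputable section

namespace CosetAlgebra

/-! The whole statement is moved into the dual of `C₀(G)`, where the algebra is transparent.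
Convolution of functionals is `convDual`, built from the slice operators on `C₀(G)`; associativity
is associativity of composition, and compatibility with the involution `starDual` is Fubini's
theorem `convDual_apply'`. So this dual is a Banach `*`-algebra.

Riesz–Markov (`exists_dual_eq`, `norm_dual`, `dual_injOn`) identifies regular complex measures on
`G/H` isometrically with functionals on `C₀(G/H)`. Averaging over `H` sends `C₀(G)` onto `C₀(G/H)`,
and its transpose `lift` embeds the dual of `C₀(G/H)` isometrically into that of `C₀(G)`. Let `m` be
integration over `H`. The image of `lift` consists of the `Λ` with `Λ ⋆ m = Λ`; left `H`-invariance
is the further equation `m ⋆ Λ = Λ`. Thus the invariant measures become the functionals fixed by the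
self-adjoint `m` on both sides. This set is closed and stable under product and involution, so
`IsIsometricStarEmbedding.isBanachStarAlgebra` transfers the axioms to it.

For functions, `densityIsometry` embeds `L¹(G/H)` in the dual of `C₀(G/H)` with closed range. On
`C_c(G/H)`, Weil's formula turns `F dμ` into `(F ∘ q) dσ` on `G`, so the prescribed convolution and
involution agree with those of functionals (`cosetConv_densityDual`, `cosetStar_densityDual`). By
density the range is stable under both operations. This constructs the extensions to `L¹`, shows
that `φ ↦ μ_φ` respects them, and gives the Banach `*`-algebra structure of `A¹` by a second
transfer. -/

/-- The seminormed group structure on `C₀(X)` that underlies its normed group structure. -/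
instance instSeminormedAddCommGroupZeroAtInfty {X : Type*} [TopologicalSpace X] :
    SeminormedAddCommGroup C₀(X, ℂ) :=
  NormedAddCommGroup.toSeminormedAddCommGroup

instance instNormedSpaceZeroAtInfty {X : Type*} [TopologicalSpace X] :
    NormedSpace ℂ C₀(X, ℂ) :=
  inferInstance

/-! ### Complex measures: densities, integrals and variation -/

section ComplexMeasureTheory

variable {X : Type*} [MeasurableSpace X]

instance isFiniteMeasure_variation_signed (s : SignedMeasure X) : IsFiniteMeasure s.variation := by
  rw [← SignedMeasure.totalVariation_eq_variation]
  unfold SignedMeasure.totalVariation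
  infer_instance

instance isFiniteMeasure_variation (κ : ComplexMeasure X) : IsFiniteMeasure κ.variation := by
  refine isFiniteMeasure_of_le (κ.re.variation + κ.im.variation) ?_
  refine VectorMeasure.variation_le_of_forall_enorm_le fun E _ => ?_
  have h : κ E = ((κ.re E : ℝ) : ℂ) + Complex.I * ((κ.im E : ℝ) : ℂ) := by
    rw [mul_comm]; exact (Complex.re_add_im (κ E)).symm
  calc ‖κ E‖ₑ ≤ ‖((κ.re E : ℝ) : ℂ)‖ₑ + ‖Complex.I * ((κ.im E : ℝ) : ℂ)‖ₑ := by
        rw [h]; exact enorm_add_le _ _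
    _ = ‖κ.re E‖ₑ + ‖κ.im E‖ₑ := by
        congr 1 <;> simp [enorm_eq_nnnorm]
    _ ≤ κ.re.variation E + κ.im.variation E :=
        add_le_add (VectorMeasure.enorm_measure_le_variation _ _)
          (VectorMeasure.enorm_measure_le_variation _ _)

/-- Polar decomposition: a complex measure has an integrable density with respect to its
variation. -/
theorem exists_density (κ : ComplexMeasure X) :
    ∃ u : X → ℂ, Integrable u κ.variation ∧ κ.variation.withDensityᵥ u = κ := by
  -- The variation dominates both the real and the imaginary part, so Radon–Nikodym applies to each.
  have hac := (κ.absolutelyContinuous_ennreal_iff _).1 (VectorMeasure.absolutelyContinuous κ)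
  have h1 := κ.re.withDensityᵥ_rnDeriv_eq κ.variation hac.1
  have h2 := κ.im.withDensityᵥ_rnDeriv_eq κ.variation hac.2
  have i1 := SignedMeasure.integrable_rnDeriv κ.re κ.variation
  have i2 := SignedMeasure.integrable_rnDeriv κ.im κ.variation
  have j1 : Integrable (fun x => (κ.re.rnDeriv κ.variation x : ℂ)) κ.variation := i1.ofReal
  have j2 : Integrable (fun x => (κ.im.rnDeriv κ.variation x : ℂ) * Complex.I) κ.variation :=
    i2.ofReal.mul_const _
  have j12 : Integrable (fun x => (κ.re.rnDeriv κ.variation x : ℂ) +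
    (κ.im.rnDeriv κ.variation x : ℂ) * Complex.I) κ.variation := j1.add j2
  refine ⟨_, j12, ?_⟩
  ext E hE
  rw [withDensityᵥ_apply j12 hE, integral_add j1.integrableOn.integrable
    j2.integrableOn.integrable, integral_mul_const]
  have e1 : ∫ x in E, (κ.re.rnDeriv κ.variation x : ℂ) ∂κ.variation = ((κ.re E : ℝ) : ℂ) := by
    rw [integral_complex_ofReal, ← withDensityᵥ_apply i1 hE, h1]
  have e2 : ∫ x in E, (κ.im.rnDeriv κ.variation x : ℂ) ∂κ.variation = ((κ.im E : ℝ) : ℂ) := by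
    rw [integral_complex_ofReal, ← withDensityᵥ_apply i2 hE, h2]
  rw [e1, e2]
  exact Complex.re_add_im (κ E)

/-- The variation of `u dp` is `|u| dp`. Measurability of `f` is known only where `u ≠ 0`, but the
factor `u` kills the remaining set. -/
theorem integrable_mul_of_integrable_variation {p : Measure X} {u : X → ℂ} (hu : Integrable u p)
    {f : X → ℂ} (hf : Integrable f (p.withDensityᵥ u).variation) :
    Integrable (fun x => f x * u x) p ∧
      ∫ x, ‖f x * u x‖ ∂p = ∫ x, ‖f x‖ ∂(p.withDensityᵥ u).variation := by
  rw [Measure.variation_withDensityᵥ hu] at hf ⊢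
  have hm : AEMeasurable (fun x => ‖u x‖₊) p := hu.1.nnnorm.aemeasurable
  have h1 : Integrable (fun x => ‖u x‖₊ • f x) p :=
    (integrable_withDensity_iff_integrable_smul₀ hm).1 hf
  have h2 : AEStronglyMeasurable (fun x => f x * u x) p := by
    obtain ⟨g, hg, hfg⟩ := hf.1
    refine (hg.aestronglyMeasurable.mul hu.1).congr ?_
    have h3 : ∀ᵐ x ∂p, (‖u x‖₊ : ENNReal) ≠ 0 → f x = g x :=
      (ae_withDensity_iff' hm.coe_nnreal_ennreal).1 hfg
    filter_upwards [h3] with x hx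
    by_cases h0 : u x = 0
    · simp [h0]
    · simp [hx (by simpa using h0)]
  refine ⟨h1.mono h2 (ae_of_all _ fun x => ?_), ?_⟩
  · simp [NNReal.smul_def, mul_comm]
  · refine Eq.trans ?_ (integral_withDensity_eq_integral_smul₀ hm _).symm
    refine integral_congr_ae (ae_of_all _ fun x => ?_)
    simp [NNReal.smul_def, mul_comm]

/-- Induction on integrable functions. With `exists_density` this reduces every integral against a
complex measure to an ordinary Bochner integral. -/
theorem cIntegral_withDensityᵥ {p : Measure X} {u : X → ℂ} (hu : Integrable u p)
    {f : X → ℂ} (hf : Integrable f (p.withDensityᵥ u).variation) :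
    cIntegral (p.withDensityᵥ u) f = ∫ x, f x * u x ∂p := by
  revert f
  refine Integrable.induction _ ?_ ?_ ?_ ?_
  · intro c s hs _
    unfold cIntegral
    rw [VectorMeasure.integral_indicator_const _ hs, withDensityᵥ_apply hu hs,
      ContinuousLinearMap.mul_apply', ← integral_const_mul, ← integral_indicator hs]
    refine integral_congr_ae (ae_of_all _ fun x => ?_)
    by_cases hx : x ∈ s <;> simp [hx]
  · intro f g _ hf hg h1 h2
    unfold cIntegral at h1 h2 ⊢
    rw [VectorMeasure.integral_add hf hg, h1, h2, ← integral_add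
      (integrable_mul_of_integrable_variation hu hf).1
      (integrable_mul_of_integrable_variation hu hg).1]
    simp only [Pi.add_apply, add_mul]
  · refine isClosed_eq VectorMeasure.continuous_integral ?_
    -- The right side is 1-Lipschitz, because `∫ |f u| dp` is exactly the `L¹` norm of `f` for the
    -- variation.
    refine LipschitzWith.continuous (K := 1) (LipschitzWith.of_dist_le_mul fun f g => ?_)
    have hfg := integrable_mul_of_integrable_variation hu
      ((L1.integrable_coeFn f).sub (L1.integrable_coeFn g))
    rw [dist_eq_norm, ← integral_sub
      (integrable_mul_of_integrable_variation hu (L1.integrable_coeFn f)).1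
      (integrable_mul_of_integrable_variation hu (L1.integrable_coeFn g)).1,
      NNReal.coe_one, one_mul, L1.dist_eq_integral_dist]
    simp only [dist_eq_norm]
    simp only [Pi.sub_apply] at hfg
    rw [← hfg.2]
    simp only [← sub_mul]
    exact norm_integral_le_integral_norm _
  · intro f g hfg hf h
    unfold cIntegral at h ⊢
    rw [← VectorMeasure.integral_congr_ae hfg, h]
    refine integral_congr_ae ?_
    rw [Measure.variation_withDensityᵥ hu] at hfg
    have h3 := (ae_withDensity_iff' (μ := p) (f := fun x => ‖u x‖ₑ) hu.1.enorm).1 hfg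
    filter_upwards [h3] with x hx
    by_cases h0 : u x = 0
    · simp [h0]
    · simp [hx (by simpa using h0)]

theorem cIntegral_congr {κ : ComplexMeasure X} {f g : X → ℂ} (h : ∀ x, f x = g x) :
    cIntegral κ f = cIntegral κ g := by rw [funext h]

theorem cIntegral_add {κ : ComplexMeasure X} {f g : X → ℂ} (hf : Integrable f κ.variation)
    (hg : Integrable g κ.variation) :
    cIntegral κ (fun x => f x + g x) = cIntegral κ f + cIntegral κ g :=
  VectorMeasure.integral_fun_add hf hg

/-- The pairing that defines `cIntegral` is only real bilinear, so complex homogeneity is read off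
from a density. -/
theorem cIntegral_const_mul {κ : ComplexMeasure X} {f : X → ℂ} (hf : Integrable f κ.variation)
    (c : ℂ) : cIntegral κ (fun x => c * f x) = c * cIntegral κ f := by
  obtain ⟨u, hu, hκ⟩ := exists_density κ
  have h1 := cIntegral_withDensityᵥ hu (f := f) (by rwa [hκ])
  have h2 := cIntegral_withDensityᵥ hu (f := fun x => c * f x) (by rw [hκ]; exact hf.const_mul c)
  rw [hκ] at h1 h2
  rw [h1, h2, ← integral_const_mul]
  simp only [mul_assoc]

theorem cIntegral_add_measure {κ κ' : ComplexMeasure X} {f : X → ℂ}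
    (hf : Integrable f κ.variation) (hf' : Integrable f κ'.variation) :
    cIntegral (κ + κ') f = cIntegral κ f + cIntegral κ' f :=
  VectorMeasure.integral_add_vectorMeasure hf hf'

theorem cIntegral_smul_measure {κ : ComplexMeasure X} {f : X → ℂ}
    (hf : Integrable f κ.variation) (c : ℂ) : cIntegral (c • κ) f = c * cIntegral κ f := by
  obtain ⟨u, hu, hκ⟩ := exists_density κ
  have h1 := cIntegral_withDensityᵥ hu (f := f) (by rwa [hκ])
  have h3 : κ.variation.withDensityᵥ (c • u) = c • κ := by
    rw [withDensityᵥ_smul u c, hκ]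
  have h2 := cIntegral_withDensityᵥ (hu.smul c) (f := f) (by
    rw [h3, VectorMeasure.variation_smul]; exact hf.smul_measure_nnreal)
  rw [hκ] at h1
  rw [h3] at h2
  rw [h1, h2, ← integral_const_mul]
  refine integral_congr_ae (ae_of_all _ fun x => ?_)
  simp only [Pi.smul_apply, smul_eq_mul]
  ring

theorem variation_conjMeasure (κ : ComplexMeasure X) :
    (conjMeasure κ).variation = κ.variation := by
  have h : ∀ E, ‖conjMeasure κ E‖ₑ = ‖κ E‖ₑ := fun E => by
    change ‖starRingEnd ℂ (κ E)‖ₑ = _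
    simp [enorm_eq_nnnorm]
  refine le_antisymm ?_ ?_ <;>
  refine VectorMeasure.variation_le_of_forall_enorm_le fun E _ => ?_
  · rw [h]; exact VectorMeasure.enorm_measure_le_variation _ _
  · rw [← h]; exact VectorMeasure.enorm_measure_le_variation _ _

theorem cIntegral_conjMeasure {κ : ComplexMeasure X} {f : X → ℂ} (hf : Integrable f κ.variation) :
    cIntegral (conjMeasure κ) f = starRingEnd ℂ (cIntegral κ fun x => starRingEnd ℂ (f x)) := by
  obtain ⟨u, hu, hκ⟩ := exists_density κ
  have hu' : Integrable (fun x => starRingEnd ℂ (u x)) κ.variation :=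
    (RCLike.conjCLE (K := ℂ)).toContinuousLinearMap.integrable_comp hu
  have hf' : Integrable (fun x => starRingEnd ℂ (f x)) κ.variation :=
    (RCLike.conjCLE (K := ℂ)).toContinuousLinearMap.integrable_comp hf
  have h3 : κ.variation.withDensityᵥ (fun x => starRingEnd ℂ (u x)) = conjMeasure κ := by
    ext E hE
    rw [withDensityᵥ_apply hu' hE, integral_conj, ← withDensityᵥ_apply hu hE, hκ]
    rfl
  have h1 := cIntegral_withDensityᵥ hu (f := fun x => starRingEnd ℂ (f x)) (by rwa [hκ])
  have h2 := cIntegral_withDensityᵥ hu' (f := f) (by rwa [h3, variation_conjMeasure])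
  rw [hκ] at h1
  rw [h3] at h2
  rw [h1, h2, ← integral_conj]
  simp

theorem norm_cIntegral_le (κ : ComplexMeasure X) {f : X → ℂ} {C : ℝ} (h : ∀ x, ‖f x‖ ≤ C) :
    ‖cIntegral κ f‖ ≤ C * tvNorm κ := by
  obtain _ | ⟨⟨x⟩⟩ := isEmpty_or_nonempty X
  · simp [cIntegral, VectorMeasure.integral_of_isEmpty, tvNorm, VectorMeasure.eq_zero_of_isEmpty]
  have hC : 0 ≤ C := (norm_nonneg _).trans (h x)
  refine (VectorMeasure.norm_integral_le_of_norm_le_const (ae_of_all _ h)).trans ?_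
  calc C * ‖ContinuousLinearMap.mul ℝ ℂ‖ * κ.variation.real Set.univ
      ≤ C * 1 * κ.variation.real Set.univ := by
        gcongr; exact ContinuousLinearMap.opNorm_mul_le ℝ ℂ
    _ = C * tvNorm κ := by rw [mul_one]; rfl

theorem tvNorm_withDensityᵥ {p : Measure X} {u : X → ℂ} (hu : Integrable u p) :
    tvNorm (p.withDensityᵥ u) = ∫ x, ‖u x‖ ∂p := by
  rw [tvNorm, Measure.variation_withDensityᵥ hu, Measure.real,
    withDensity_apply _ MeasurableSet.univ, Measure.restrict_univ,
    integral_norm_eq_lintegral_enorm hu.1]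

end ComplexMeasureTheory

/-! ### Regular measures and the functionals they define -/

section RegularMeasures

variable {X : Type*} [TopologicalSpace X] [MeasurableSpace X] [BorelSpace X]

/-- A compact `K ⊆ A` with `m (A \ K)` small has `ν (A \ K)` small as well, which is inner
regularity; finiteness of `ν` gives the rest. -/
theorem regular_of_le [T2Space X] {ν m : Measure X} [IsFiniteMeasure m] [m.Regular] (h : ν ≤ m) :
    ν.Regular := by
  have : IsFiniteMeasure ν := isFiniteMeasure_of_le m h
  have : ν.InnerRegularCompactLTTop := by
    refine ⟨fun A hA r hr => ?_⟩
    obtain ⟨K, hKA, hK, hlt⟩ := hA.1.exists_isCompact_sdiff_lt (measure_ne_top m A)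
      (tsub_pos_of_lt hr).ne'
    refine ⟨K, hKA, hK, ?_⟩
    by_contra hcon
    have h1 : ν A ≤ ν K + ν (A \ K) := by
      rw [← measure_sdiff_add_inter A hK.measurableSet, add_comm]
      gcongr
      exact Set.inter_subset_right
    have h2 : ν (A \ K) < ν A - r := (h _).trans_lt hlt
    have h3 : ν A < r + (ν A - r) :=
      h1.trans_lt (ENNReal.add_lt_add_of_le_of_lt (measure_ne_top ν K) (not_lt.1 hcon) h2)
    rw [add_tsub_cancel_of_le hr.le] at h3
    exact lt_irrefl _ h3
  infer_instance

theorem integrable_zeroAtInfty (p : Measure X) [IsFiniteMeasure p] (ψ : C₀(X, ℂ)) :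
    Integrable ψ p :=
  Integrable.of_bound ψ.continuous.aestronglyMeasurable ‖ψ‖
    (ae_of_all _ fun x => ψ.toBCF.norm_coe_le_norm x)

/-- The functional on `C₀(X)` given by a complex measure. -/
def dual (κ : ComplexMeasure X) : C₀(X, ℂ) →L[ℂ] ℂ :=
  LinearMap.mkContinuous
    { toFun := fun ψ => cIntegral κ ψ
      map_add' := fun f g => cIntegral_add (integrable_zeroAtInfty _ f) (integrable_zeroAtInfty _ g)
      map_smul' := fun c f => cIntegral_const_mul (integrable_zeroAtInfty _ f) c }
    (tvNorm κ) fun ψ => by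
      rw [mul_comm]
      exact norm_cIntegral_le κ fun x => ψ.toBCF.norm_coe_le_norm x

theorem dual_apply (κ : ComplexMeasure X) (ψ : C₀(X, ℂ)) : dual κ ψ = cIntegral κ ψ := rfl

omit [TopologicalSpace X] [BorelSpace X] in
theorem tvNorm_nonneg (κ : ComplexMeasure X) : 0 ≤ tvNorm κ := ENNReal.toReal_nonneg

theorem norm_dual_le (κ : ComplexMeasure X) : ‖dual κ‖ ≤ tvNorm κ :=
  LinearMap.mkContinuous_norm_le _ (tvNorm_nonneg κ) _

theorem dual_add (κ κ' : ComplexMeasure X) : dual (κ + κ') = dual κ + dual κ' := by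
  ext ψ
  exact cIntegral_add_measure (integrable_zeroAtInfty _ ψ) (integrable_zeroAtInfty _ ψ)

theorem dual_smul (c : ℂ) (κ : ComplexMeasure X) : dual (c • κ) = c • dual κ := by
  ext ψ
  exact cIntegral_smul_measure (integrable_zeroAtInfty _ ψ) c

theorem regular_add [T2Space X] {κ κ' : ComplexMeasure X} (h : κ ∈ regularMeasures X)
    (h' : κ' ∈ regularMeasures X) : κ + κ' ∈ regularMeasures X := by
  have : κ.variation.Regular := h
  have : κ'.variation.Regular := h'
  have : (κ.variation + κ'.variation).Regular := inferInstance
  exact regular_of_le VectorMeasure.variation_add_le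

omit [BorelSpace X] in
theorem regular_smul (c : ℂ) {κ : ComplexMeasure X} (h : κ ∈ regularMeasures X) :
    c • κ ∈ regularMeasures X := by
  have : κ.variation.Regular := h
  change (c • κ).variation.Regular
  rw [VectorMeasure.variation_smul]
  infer_instance

end RegularMeasures

/-! ### Approximation by compactly supported functions and duality for `L¹` -/

section Riesz

open scoped NNReal

variable {X : Type*} [TopologicalSpace X]

theorem norm_zeroAtInfty_le (ψ : C₀(X, ℂ)) {C : ℝ} (hC : 0 ≤ C) (h : ∀ x, ‖ψ x‖ ≤ C) :
    ‖ψ‖ ≤ C := by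
  rw [← ZeroAtInftyContinuousMap.norm_toBCF_eq_norm]
  exact (BoundedContinuousFunction.norm_le hC).2 h

theorem norm_apply_le (ψ : C₀(X, ℂ)) (x : X) : ‖ψ x‖ ≤ ‖ψ‖ :=
  ψ.toBCF.norm_coe_le_norm x

/-- A continuous function with compact support as an element of `C₀(X)`. -/
def ofCompactSupport (f : X → ℂ) (hf : Continuous f) (h : HasCompactSupport f) : C₀(X, ℂ) :=
  ⟨⟨f, hf⟩, h.is_zero_at_infty⟩

@[simp]
theorem ofCompactSupport_apply (f : X → ℂ) (hf : Continuous f) (h : HasCompactSupport f) (x : X) :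
    ofCompactSupport f hf h x = f x := rfl

variable [T2Space X] [LocallyCompactSpace X]

/-- The functions with compact support are dense in `C₀(X)`. -/
theorem exists_compactSupport_norm_sub_le (ψ : C₀(X, ℂ)) {ε : ℝ} (hε : 0 < ε) :
    ∃ φ : C₀(X, ℂ), HasCompactSupport φ ∧ ‖ψ - φ‖ ≤ ε := by
  have h1 : ∀ᶠ x in cocompact X, ‖ψ x‖ < ε := by
    have := (ψ.zero_at_infty').norm
    rw [norm_zero] at this
    exact this.eventually_lt_const hε
  obtain ⟨K, hK, hKε⟩ := mem_cocompact.1 h1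
  obtain ⟨f, hf1, -, hfc, hf⟩ := exists_continuous_one_zero_of_isCompact hK isClosed_empty
    (Set.disjoint_empty K)
  have hc : HasCompactSupport fun x => (f x : ℂ) * ψ x :=
    (hfc.comp_left (g := fun r : ℝ => (r : ℂ)) Complex.ofReal_zero).mul_right
  refine ⟨ofCompactSupport _ (by fun_prop) hc, hc, norm_zeroAtInfty_le _ hε.le fun x => ?_⟩
  change ‖ψ x - f x * ψ x‖ ≤ ε
  by_cases hx : x ∈ K
  · rw [hf1 hx]; simp [hε.le]
  · have h2 : ‖ψ x‖ < ε := hKε hx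
    have h3 : ψ x - f x * ψ x = ((1 - f x : ℝ) : ℂ) * ψ x := by push_cast; ring
    rw [h3, norm_mul, Complex.norm_real, Real.norm_of_nonneg (by linarith [(hf x).2])]
    nlinarith [(hf x).1, (hf x).2, norm_nonneg (ψ x)]

theorem functional_ext {Λ Λ' : C₀(X, ℂ) →L[ℂ] ℂ}
    (h : ∀ φ : C₀(X, ℂ), HasCompactSupport φ → Λ φ = Λ' φ) : Λ = Λ' := by
  have hd : Dense {φ : C₀(X, ℂ) | HasCompactSupport φ} := by
    intro ψ
    rw [Metric.mem_closure_iff]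
    intro ε hε
    obtain ⟨φ, h1, h2⟩ := exists_compactSupport_norm_sub_le ψ (half_pos hε)
    exact ⟨φ, h1, by rw [dist_eq_norm]; linarith⟩
  exact ContinuousLinearMap.coeFn_injective (Continuous.ext_on hd Λ.continuous Λ'.continuous h)

variable [MeasurableSpace X] [BorelSpace X]

/-- Integrable functions are approximated by continuous functions with compact support. -/
theorem exists_compactSupport_integral_norm_sub_le {p : Measure X} [p.Regular] {f : X → ℂ}
    (hf : Integrable f p) {ε : ℝ} (hε : 0 < ε) :
    ∃ g : X → ℂ, HasCompactSupport g ∧ ∫ x, ‖f x - g x‖ ∂p ≤ ε ∧ Continuous g := by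
  have key : ∀ (c : ℂ) ⦃t : Set X⦄, MeasurableSet t → p t < ⊤ → ∀ {δ : ENNReal}, δ ≠ 0 →
      ∃ g : X → ℂ, eLpNorm (g - t.indicator fun _ => c) 1 p ≤ δ ∧
        (Continuous g ∧ HasCompactSupport g) := by
    intro c t ht htp δ hδ
    obtain ⟨η, hη0, hη⟩ := exists_eLpNorm_indicator_le (μ := p) ENNReal.one_ne_top c hδ
    have hη2 : (η : ENNReal) / 2 ≠ 0 := by simpa using hη0.ne'
    obtain ⟨K, hKt, hK, hKη⟩ := ht.exists_isCompact_sdiff_lt htp.ne hη2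
    -- A Urysohn function for `K ⊆ V` differs from the indicator of `t` only on `V \ K ∪ t \ K`;
    -- each piece receives half of `η`.
    obtain ⟨V, hKV, hV, -, hVη⟩ := hK.measurableSet.exists_isOpen_sdiff_lt
      (hK.measure_lt_top (μ := p)).ne hη2
    obtain ⟨g, hg1, hg0, hgc, hg⟩ := exists_continuous_one_zero_of_isCompact hK hV.isClosed_compl
      (Set.disjoint_compl_right_iff_subset.2 hKV)
    refine ⟨fun x => g x • c, (eLpNorm_mono fun x => ?_).trans
      (hη (V \ K ∪ t \ K) ?_), by fun_prop, hgc.smul_right⟩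
    · simp only [Pi.sub_apply]
      by_cases hxK : x ∈ K
      · rw [Set.indicator_of_mem (hKt hxK), hg1 hxK]; simp
      by_cases hxV : x ∈ V
      · rw [Set.indicator_of_mem (show x ∈ V \ K ∪ t \ K from Or.inl ⟨hxV, hxK⟩)]
        by_cases hxt : x ∈ t
        · rw [Set.indicator_of_mem hxt]
          have : g x • c - c = (g x - 1) • c := by rw [sub_smul, one_smul]
          rw [this, norm_smul, Real.norm_eq_abs]
          exact mul_le_of_le_one_left (norm_nonneg _)
            (abs_le.2 ⟨by linarith [(hg x).1], by linarith [(hg x).2]⟩)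
        · rw [Set.indicator_of_notMem hxt, sub_zero, norm_smul, Real.norm_of_nonneg (hg x).1]
          exact mul_le_of_le_one_left (norm_nonneg _) (hg x).2
      · rw [hg0 hxV]
        by_cases hxt : x ∈ t
        · rw [Set.indicator_of_mem hxt, 
            Set.indicator_of_mem (show x ∈ V \ K ∪ t \ K from Or.inr ⟨hxt, hxK⟩)]
          simp
        · rw [Set.indicator_of_notMem hxt]; simp
    · refine (measure_union_le _ _).trans ?_
      rw [← ENNReal.add_halves (η : ENNReal)]
      exact add_le_add hVη.le hKη.le
  obtain ⟨g, h1, h2, h3⟩ := MemLp.induction_dense ENNReal.one_ne_top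
    (fun g : X → ℂ => Continuous g ∧ HasCompactSupport g) key
    (fun f g hf hg => ⟨hf.1.add hg.1, hf.2.add hg.2⟩)
    (fun f hf => hf.1.aestronglyMeasurable) (memLp_one_iff_integrable.2 hf)
    (ε := ENNReal.ofReal ε) (ENNReal.ofReal_pos.2 hε).ne'
  refine ⟨g, h3, ?_, h2⟩
  have hg : Integrable g p := h2.integrable_of_hasCompactSupport h3
  rw [eLpNorm_one_eq_lintegral_enorm] at h1
  change ∫ x, ‖(f - g) x‖ ∂p ≤ ε
  rw [integral_norm_eq_lintegral_enorm (hf.sub hg).1]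
  exact ENNReal.toReal_le_of_le_ofReal hε.le h1

/-- If `∫ ψ f dp` is bounded by `C ‖ψ‖`, then the `L¹`-norm of `f` is at most `C`. -/
theorem integral_norm_le_of_forall {p : Measure X} [p.Regular] {f : X → ℂ} (hf : Integrable f p)
    {C : ℝ} (hC : 0 ≤ C) (h : ∀ ψ : C₀(X, ℂ), ‖∫ x, ψ x * f x ∂p‖ ≤ C * ‖ψ‖) : ∫ x, ‖f x‖ ∂p ≤ C := by
  refine le_of_forall_pos_le_add fun ε hε => ?_
  obtain ⟨g, hgc, hgε, hg⟩ := exists_compactSupport_integral_norm_sub_le hf (ε := ε / 3)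
    (by positivity)
  have hgi : Integrable g p := hg.integrable_of_hasCompactSupport hgc
  set M := p.real (tsupport g) with hM
  have hM0 : 0 ≤ M := measureReal_nonneg
  -- Regularizing the phase of `g` by `δ` loses at most `δ` at each point of the support of `g`,
  -- hence at most `δ * M` in total.
  set δ := ε / (3 * (M + 1)) with hδ
  have hδ0 : 0 < δ := by positivity
  have hδM : δ * M ≤ ε / 3 := by
    rw [hδ, div_mul_eq_mul_div, div_le_div_iff₀ (by positivity) (by positivity)]
    nlinarith
  have hne : ∀ x, ((‖g x‖ + δ : ℝ) : ℂ) ≠ 0 := fun x => by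
    rw [Complex.ofReal_ne_zero]; positivity
  -- A continuous substitute for the phase `conj g / |g|`, which may have no continuous extension to
  -- the zeros of `g`.
  let ψf : X → ℂ := fun x => starRingEnd ℂ (g x) / ((‖g x‖ + δ : ℝ) : ℂ)
  have hψc : Continuous ψf := by
    refine Continuous.div (Complex.continuous_conj.comp hg) ?_ hne
    exact Complex.continuous_ofReal.comp (hg.norm.add continuous_const)
  have hψs : HasCompactSupport ψf := by
    refine hgc.mono fun x hx => ?_
    contrapose! hx
    simp only [Function.mem_support, not_not] at hx ⊢
    simp [ψf, hx]
  set ψ := ofCompactSupport ψf hψc hψs with hψ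
  have hψ1 : ∀ x, ‖ψ x‖ ≤ 1 := fun x => by
    change ‖ψf x‖ ≤ 1
    have : (0:ℝ) < ‖g x‖ + δ := by positivity
    simp only [ψf, norm_div, RCLike.norm_conj, Complex.norm_real, Real.norm_of_nonneg this.le]
    rw [div_le_one this]; linarith
  have hψn : ‖ψ‖ ≤ 1 := norm_zeroAtInfty_le _ zero_le_one hψ1
  have hψm : AEStronglyMeasurable (fun x => ψ x) p := hψc.aestronglyMeasurable
  have i1 : Integrable (fun x => ψ x * f x) p := hf.bdd_mul hψm (ae_of_all _ hψ1)
  have i2 : Integrable (fun x => ψ x * g x) p := hgi.bdd_mul hψm (ae_of_all _ hψ1)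
  have e1 : ‖∫ x, ψ x * g x ∂p - ∫ x, ψ x * f x ∂p‖ ≤ ε / 3 := by
    rw [← integral_sub i2 i1]
    refine (norm_integral_le_integral_norm _).trans (le_trans ?_ hgε)
    refine integral_mono (i2.sub i1).norm (hf.sub hgi).norm fun x => ?_
    simp only
    rw [← mul_sub, norm_mul, norm_sub_rev (f x)]
    exact mul_le_of_le_one_left (norm_nonneg _) (hψ1 x)
  have e2 : ∫ x, ‖f x‖ ∂p ≤ ∫ x, ‖g x‖ ∂p + ε / 3 := by
    have : ∫ x, ‖f x‖ ∂p - ∫ x, ‖g x‖ ∂p ≤ ∫ x, ‖f x - g x‖ ∂p := by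
      rw [← integral_sub hf.norm hgi.norm]
      exact integral_mono (hf.norm.sub hgi.norm) (hf.sub hgi).norm fun x => norm_sub_norm_le _ _
    linarith
  have e3 : ∫ x, ‖g x‖ ∂p - δ * M ≤ ‖∫ x, ψ x * g x ∂p‖ := by
    have h1 : ∀ x, ψ x * g x = ((‖g x‖ ^ 2 / (‖g x‖ + δ) : ℝ) : ℂ) := fun x => by
      change ψf x * g x = _
      simp only [ψf]
      rw [div_mul_eq_mul_div, Complex.conj_mul']
      push_cast
      rfl
    have i3 : Integrable (fun x => ‖g x‖ ^ 2 / (‖g x‖ + δ)) p := by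
      have := i2.re
      refine this.congr (ae_of_all _ fun x => ?_)
      simp only [h1]
      exact Complex.ofReal_re _
    have i4 : Integrable ((tsupport g).indicator fun _ => δ) p :=
      (integrable_indicator_iff (isClosed_tsupport g).measurableSet).2
        (integrableOn_const hgc.measure_ne_top)
    simp only [h1]
    rw [integral_complex_ofReal, Complex.norm_real]
    refine le_trans ?_ (le_abs_self _)
    have h4 : δ * M = ∫ x, (tsupport g).indicator (fun _ => δ) x ∂p := by
      rw [integral_indicator_const _ (isClosed_tsupport g).measurableSet, smul_eq_mul, mul_comm]
    rw [h4, ← integral_sub hgi.norm i4]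
    refine integral_mono (hgi.norm.sub i4) i3 fun x => ?_
    simp only
    by_cases hx : x ∈ tsupport g
    · rw [Set.indicator_of_mem hx, le_div_iff₀ (by positivity)]
      -- This is `(|g| - δ)(|g| + δ) ≤ |g|²`.
      nlinarith [sq_nonneg δ, norm_nonneg (g x)]
    · rw [Set.indicator_of_notMem hx, image_eq_zero_of_notMem_tsupport hx]
      simp
  have e4 : ‖∫ x, ψ x * g x ∂p‖ ≤ ‖∫ x, ψ x * f x ∂p‖ + ε / 3 := by
    have := norm_le_norm_add_norm_sub' (∫ x, ψ x * g x ∂p) (∫ x, ψ x * f x ∂p)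
    linarith
  have e5 : ‖∫ x, ψ x * f x ∂p‖ ≤ C := (h ψ).trans (mul_le_of_le_one_right hC hψn)
  linarith

end Riesz

/-! ### Riesz–Markov representation by regular complex measures -/

section RieszRepresentation

open scoped NNReal

variable {X : Type*} [TopologicalSpace X]

section PositivePart

variable {r : C_c(X, ℝ≥0) → ℝ} {C : ℝ}

theorem exists_bound (f : C_c(X, ℝ≥0)) : ∃ M : ℝ≥0, ∀ x, f x ≤ M := by
  obtain ⟨M, hM⟩ := (f.hasCompactSupport.isCompact_range f.continuous).bddAbove
  exact ⟨M, fun x => hM ⟨x, rfl⟩⟩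

/-- The positive part `f ↦ sup {r g : g ≤ f}` of a functional. -/
def posPartFun (r : C_c(X, ℝ≥0) → ℝ) (f : C_c(X, ℝ≥0)) : ℝ := sSup (r '' {g | g ≤ f})

theorem le_posPartFun (hb : ∀ (f : C_c(X, ℝ≥0)) (M : ℝ≥0), (∀ x, f x ≤ M) → |r f| ≤ C * M)
    {f g : C_c(X, ℝ≥0)} (h : g ≤ f) : r g ≤ posPartFun r f := by
  refine le_csSup ?_ ⟨g, h, rfl⟩
  obtain ⟨M, hM⟩ := exists_bound f
  refine ⟨C * M, ?_⟩
  rintro _ ⟨k, hk, rfl⟩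
  exact (le_abs_self _).trans (hb k M fun x => (hk x).trans (hM x))

theorem posPartFun_le {f : C_c(X, ℝ≥0)} {a : ℝ} (h : ∀ g ≤ f, r g ≤ a) : posPartFun r f ≤ a := by
  refine csSup_le ⟨_, f, le_refl f, rfl⟩ ?_
  rintro _ ⟨k, hk, rfl⟩
  exact h k hk

/-- Riesz decomposition: if `g ≤ f₁ + f₂`, then `g` is the sum of `g ⊓ f₁ ≤ f₁` and a remainder that
is at most `f₂`. -/
theorem posPartFun_add (hr : ∀ f g, r (f + g) = r f + r g)
    (hb : ∀ (f : C_c(X, ℝ≥0)) (M : ℝ≥0), (∀ x, f x ≤ M) → |r f| ≤ C * M) (f₁ f₂ : C_c(X, ℝ≥0)) :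
    posPartFun r (f₁ + f₂) = posPartFun r f₁ + posPartFun r f₂ := by
  refine le_antisymm (posPartFun_le fun g hg => ?_) ?_
  · obtain ⟨g₂, hg₂⟩ := CompactlySupportedContinuousMap.exists_add_of_le
      (inf_le_left : g ⊓ f₁ ≤ g)
    rw [← hg₂, hr]
    refine add_le_add (le_posPartFun hb inf_le_right) (le_posPartFun hb fun x => ?_)
    have h1 : (g ⊓ f₁) x + g₂ x = g x := DFunLike.congr_fun hg₂ x
    have h2 : g x ≤ f₁ x + f₂ x := hg x
    rw [CompactlySupportedContinuousMap.inf_apply] at h1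
    rcases le_total (g x) (f₁ x) with h | h
    · rw [inf_eq_left.2 h] at h1
      have : g₂ x = 0 := by simpa using h1
      rw [this]; exact zero_le
    · rw [inf_eq_right.2 h] at h1
      rw [← h1] at h2
      exact (add_le_add_iff_left _).1 h2
  · rw [← le_sub_iff_add_le]
    refine posPartFun_le fun g₁ hg₁ => ?_
    rw [le_sub_comm]
    refine posPartFun_le fun g₂ hg₂ => ?_
    rw [le_sub_iff_add_le, add_comm, ← hr]
    exact le_posPartFun hb (add_le_add hg₁ hg₂)

theorem posPartFun_smul (hs : ∀ (c : ℝ≥0) f, r (c • f) = c * r f)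
    (hb : ∀ (f : C_c(X, ℝ≥0)) (M : ℝ≥0), (∀ x, f x ≤ M) → |r f| ≤ C * M) (c : ℝ≥0)
    (f : C_c(X, ℝ≥0)) : posPartFun r (c • f) = c * posPartFun r f := by
  have key : ∀ (c : ℝ≥0), c ≠ 0 → ∀ f, posPartFun r (c • f) ≤ c * posPartFun r f := by
    intro c hc f
    refine posPartFun_le fun g hg => ?_
    have h1 : c⁻¹ • g ≤ f := fun x => by
      have := hg x
      simp only [CompactlySupportedContinuousMap.smul_apply, smul_eq_mul] at this ⊢
      rwa [inv_mul_le_iff₀ (pos_iff_ne_zero.2 hc)]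
    have h2 := le_posPartFun hb h1
    rw [hs, NNReal.coe_inv, inv_mul_le_iff₀ (by exact_mod_cast pos_iff_ne_zero.2 hc)] at h2
    exact h2
  rcases eq_or_ne c 0 with rfl | hc
  · have h0 : r 0 = 0 := by simpa using hs 0 0
    rw [zero_smul, NNReal.coe_zero, zero_mul]
    refine le_antisymm (posPartFun_le fun g hg => ?_) (h0 ▸ le_posPartFun hb le_rfl)
    have : g = 0 := le_antisymm hg fun x => zero_le
    rw [this, h0]
  · refine le_antisymm (key c hc f) ?_
    have h1 := key c⁻¹ (inv_ne_zero hc) (c • f)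
    rw [smul_smul, inv_mul_cancel₀ hc, one_smul, NNReal.coe_inv,
      le_inv_mul_iff₀ (by exact_mod_cast pos_iff_ne_zero.2 hc)] at h1
    exact h1

variable [T2Space X] [LocallyCompactSpace X] [MeasurableSpace X] [BorelSpace X]

/-- By inner regularity it suffices to bound the mass of compact sets, and each indicator lies below
a test function with values in `[0, 1]`. -/
theorem rieszMeasure_univ_le (Λ : C_c(X, ℝ≥0) →ₗ[ℝ≥0] ℝ≥0) {C : ℝ≥0}
    (h : ∀ f : C_c(X, ℝ≥0), (∀ x, f x ≤ 1) → Λ f ≤ C) :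
    NNRealRMK.rieszMeasure Λ Set.univ ≤ C := by
  rw [isOpen_univ.measure_eq_iSup_isCompact]
  refine iSup₂_le fun K _ => iSup_le fun hK => ?_
  obtain ⟨f, hf1, -, hfc, hf⟩ := exists_continuous_one_zero_of_isCompact hK isClosed_empty
    (Set.disjoint_empty K)
  let F : C_c(X, ℝ≥0) := CompactlySupportedContinuousMap.nnrealPart ⟨f, hfc⟩
  have hF : ∀ x, F x = (f x).toNNReal := fun x => rfl
  have h1 : Λ F ≤ C := h F fun x => by
    rw [hF, Real.toNNReal_le_one]; exact (hf x).2
  calc NNRealRMK.rieszMeasure Λ K = ∫⁻ x, K.indicator 1 x ∂(NNRealRMK.rieszMeasure Λ) := by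
        rw [lintegral_indicator_one hK.measurableSet]
    _ ≤ ∫⁻ x, F x ∂(NNRealRMK.rieszMeasure Λ) := by
        refine lintegral_mono fun x => ?_
        by_cases hx : x ∈ K
        · rw [Set.indicator_of_mem hx, hF, hf1 hx]; simp
        · rw [Set.indicator_of_notMem hx]; exact zero_le
    _ = Λ F := NNRealRMK.lintegral_rieszMeasure Λ F
    _ ≤ C := by exact_mod_cast h1

/-- A bounded functional on the positive cone of `C_c(X)` is the difference of two finite regular
measures. -/
theorem exists_measure_sub (hr : ∀ f g, r (f + g) = r f + r g)
    (hs : ∀ (c : ℝ≥0) f, r (c • f) = c * r f)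
    (hb : ∀ (f : C_c(X, ℝ≥0)) (M : ℝ≥0), (∀ x, f x ≤ M) → |r f| ≤ C * M) :
    ∃ p n : Measure X, p.Regular ∧ n.Regular ∧ IsFiniteMeasure p ∧ IsFiniteMeasure n ∧
      ∀ f : C_c(X, ℝ≥0), r f = ∫ x, (f x : ℝ) ∂p - ∫ x, (f x : ℝ) ∂n := by
  have h0 : r 0 = 0 := by simpa using hs 0 0
  have hpos : ∀ f, 0 ≤ posPartFun r f := fun f =>
    h0 ▸ le_posPartFun hb fun x => zero_le
  have hle : ∀ f, r f ≤ posPartFun r f := fun f => le_posPartFun hb le_rfl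
  -- Jordan decomposition `r = r⁺ - (r⁺ - r)`: both terms are positive and additive, so each is
  -- given by a measure.
  let Λp : C_c(X, ℝ≥0) →ₗ[ℝ≥0] ℝ≥0 :=
    { toFun := fun f => ⟨posPartFun r f, hpos f⟩
      map_add' := fun f g => NNReal.eq (posPartFun_add hr hb f g)
      map_smul' := fun c f => NNReal.eq (posPartFun_smul hs hb c f) }
  let Λn : C_c(X, ℝ≥0) →ₗ[ℝ≥0] ℝ≥0 :=
    { toFun := fun f => ⟨posPartFun r f - r f, sub_nonneg.2 (hle f)⟩
      map_add' := fun f g => NNReal.eq (by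
        change posPartFun r (f + g) - r (f + g) = (posPartFun r f - r f) + (posPartFun r g - r g)
        rw [posPartFun_add hr hb, hr]; ring)
      map_smul' := fun c f => NNReal.eq (by
        change posPartFun r (c • f) - r (c • f) = c * (posPartFun r f - r f)
        rw [posPartFun_smul hs hb, hs]; ring) }
  have hC : ∀ f : C_c(X, ℝ≥0), (∀ x, f x ≤ 1) → posPartFun r f ≤ C := fun f hf =>
    posPartFun_le fun g hg => (le_abs_self _).trans
      ((hb g 1 fun x => (hg x).trans (hf x)).trans_eq (by simp))
  have bp : NNRealRMK.rieszMeasure Λp Set.univ ≤ C.toNNReal :=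
    rieszMeasure_univ_le Λp fun f hf => by
      rw [← NNReal.coe_le_coe]
      exact (hC f hf).trans (Real.le_coe_toNNReal C)
  have bn : NNRealRMK.rieszMeasure Λn Set.univ ≤ (2 * C).toNNReal :=
    rieszMeasure_univ_le Λn fun f hf => by
      rw [← NNReal.coe_le_coe]
      refine le_trans ?_ (Real.le_coe_toNNReal _)
      change posPartFun r f - r f ≤ 2 * C
      have h1 := hb f 1 hf
      rw [NNReal.coe_one, mul_one] at h1
      linarith [hC f hf, neg_abs_le (r f)]
  refine ⟨NNRealRMK.rieszMeasure Λp, NNRealRMK.rieszMeasure Λn, inferInstance, inferInstance,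
    ⟨bp.trans_lt ENNReal.coe_lt_top⟩, ⟨bn.trans_lt ENNReal.coe_lt_top⟩, fun f => ?_⟩
  rw [NNRealRMK.integral_rieszMeasure, NNRealRMK.integral_rieszMeasure]
  change r f = posPartFun r f - (posPartFun r f - r f)
  ring

end PositivePart

variable [T2Space X] [LocallyCompactSpace X] [MeasurableSpace X] [BorelSpace X]

/-- A finite measure as a complex measure. -/
def toComplex (p : Measure X) : ComplexMeasure X := p.withDensityᵥ fun _ => (1 : ℂ)

theorem variation_toComplex (p : Measure X) [IsFiniteMeasure p] : (toComplex p).variation = p := by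
  rw [toComplex, Measure.variation_withDensityᵥ (integrable_const _)]
  simp

theorem toComplex_mem (p : Measure X) [IsFiniteMeasure p] [h : p.Regular] :
    toComplex p ∈ regularMeasures X := by
  change (toComplex p).variation.Regular
  rwa [variation_toComplex]

theorem dual_toComplex (p : Measure X) [IsFiniteMeasure p] (ψ : C₀(X, ℂ)) :
    dual (toComplex p) ψ = ∫ x, ψ x ∂p := by
  have h := cIntegral_withDensityᵥ (p := p) (u := fun _ => (1 : ℂ)) (integrable_const _) (f := ψ)
    (by
      change Integrable ψ (toComplex p).variation
      rw [variation_toComplex]; exact integrable_zeroAtInfty p ψ)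
  rw [dual_apply]
  exact h.trans (by simp)

/-- A nonnegative function with compact support, as a complex-valued function. -/
def complexify (f : C_c(X, ℝ≥0)) : C₀(X, ℂ) :=
  ofCompactSupport (fun x => ((f x : ℝ) : ℂ)) (by fun_prop)
    (f.hasCompactSupport.comp_left (g := fun r : ℝ≥0 => ((r : ℝ) : ℂ)) (by simp))

omit [T2Space X] [LocallyCompactSpace X] [MeasurableSpace X] [BorelSpace X] in
theorem complexify_apply (f : C_c(X, ℝ≥0)) (x : X) : complexify f x = ((f x : ℝ) : ℂ) := rfl

/-- Functionals agreeing on nonnegative functions with compact support are equal. -/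
theorem functional_ext_nonneg {Λ Λ' : C₀(X, ℂ) →L[ℂ] ℂ}
    (h : ∀ f : C_c(X, ℝ≥0), Λ (complexify f) = Λ' (complexify f)) : Λ = Λ' := by
  refine functional_ext fun φ hφ => ?_
  let R : C_c(X, ℝ) := ⟨⟨fun x => (φ x).re, by fun_prop⟩,
    hφ.comp_left (g := Complex.re) Complex.zero_re⟩
  let I : C_c(X, ℝ) := ⟨⟨fun x => (φ x).im, by fun_prop⟩,
    hφ.comp_left (g := Complex.im) Complex.zero_im⟩
  have e : φ = complexify R.nnrealPart - complexify (-R).nnrealPart +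
      Complex.I • (complexify I.nnrealPart - complexify (-I).nnrealPart) := by
    ext x
    have h1 : ∀ t : ℝ, (((t.toNNReal : ℝ≥0) : ℝ) : ℂ) - ((((-t).toNNReal : ℝ≥0) : ℝ) : ℂ) = t := by
      intro t
      rw [← Complex.ofReal_sub]
      congr 1
      rcases le_total 0 t with h | h
      · simp [h]
      · simp [h]
    change φ x = ((((φ x).re.toNNReal : ℝ≥0) : ℝ) : ℂ) - (((-(φ x).re).toNNReal : ℝ≥0) : ℝ) +
      Complex.I * (((((φ x).im.toNNReal : ℝ≥0) : ℝ) : ℂ) - (((-(φ x).im).toNNReal : ℝ≥0) : ℝ))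
    rw [h1, h1, mul_comm, Complex.re_add_im]
  rw [e]
  simp only [map_add, map_sub, map_smul, h]

/-- **Riesz–Markov**: every bounded functional on `C₀(X)` is given by a regular complex measure. -/
theorem exists_dual_eq (Γ : C₀(X, ℂ) →L[ℂ] ℂ) : ∃ κ ∈ regularMeasures X, dual κ = Γ := by
  have hadd : ∀ f g : C_c(X, ℝ≥0), complexify (f + g) = complexify f + complexify g := fun f g => by
    ext x
    simp [complexify_apply]
  have hsmul : ∀ (c : ℝ≥0) (f : C_c(X, ℝ≥0)), complexify (c • f) = (c : ℂ) • complexify f :=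
    fun c f => by
      ext x
      simp [complexify_apply]
  have hb : ∀ (f : C_c(X, ℝ≥0)) (M : ℝ≥0), (∀ x, f x ≤ M) → ‖Γ (complexify f)‖ ≤ ‖Γ‖ * M :=
    fun f M hM => Γ.le_opNorm_of_le (norm_zeroAtInfty_le _ M.2 fun x => by
      rw [complexify_apply, Complex.norm_real, NNReal.norm_eq]
      exact hM x)
  -- To be used with `l` the real and the imaginary part.
  have key : ∀ l : ℂ →L[ℝ] ℝ, ‖l‖ ≤ 1 → ∃ p n : Measure X, p.Regular ∧ n.Regular ∧
      IsFiniteMeasure p ∧ IsFiniteMeasure n ∧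
      ∀ f : C_c(X, ℝ≥0), l (Γ (complexify f)) = ∫ x, (f x : ℝ) ∂p - ∫ x, (f x : ℝ) ∂n := by
    intro l hl
    refine exists_measure_sub (r := fun f => l (Γ (complexify f))) (C := ‖Γ‖) (fun f g => ?_)
      (fun c f => ?_) fun f M hM => ?_
    · simp only [hadd, map_add]
    · have : (c : ℂ) • Γ (complexify f) = (c : ℝ) • Γ (complexify f) := by
        simp
      simp only [hsmul, map_smul, this]
      rfl
    · exact (l.le_opNorm _).trans ((mul_le_of_le_one_left (norm_nonneg _) hl).trans (hb f M hM))
  obtain ⟨p₁, n₁, _, _, _, _, h₁⟩ := key Complex.reCLM (by simp)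
  obtain ⟨p₂, n₂, _, _, _, _, h₂⟩ := key Complex.imCLM (by simp)
  refine ⟨(toComplex p₁ + (-1 : ℂ) • toComplex n₁) +
    Complex.I • (toComplex p₂ + (-1 : ℂ) • toComplex n₂), ?_, ?_⟩
  · exact regular_add (regular_add (toComplex_mem _) (regular_smul _ (toComplex_mem _)))
      (regular_smul _ (regular_add (toComplex_mem _) (regular_smul _ (toComplex_mem _))))
  · refine functional_ext_nonneg fun f => ?_
    simp only [dual_add, dual_smul, add_apply, smul_apply,
      dual_toComplex, complexify_apply, integral_complex_ofReal, smul_eq_mul]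
    rw [← Complex.re_add_im (Γ (complexify f))]
    have e1 := h₁ f
    have e2 := h₂ f
    rw [Complex.reCLM_apply] at e1
    rw [Complex.imCLM_apply] at e2
    rw [e1, e2]
    push_cast
    ring

/-- With `κ = u d|κ|`, the total variation is the `L¹` norm of `u`, which test functions in `C₀`
already detect since `|κ|` is regular. -/
theorem norm_dual {κ : ComplexMeasure X} (hκ : κ ∈ regularMeasures X) : ‖dual κ‖ = tvNorm κ := by
  refine le_antisymm (norm_dual_le κ) ?_
  have : κ.variation.Regular := hκ
  obtain ⟨u, hu, h⟩ := exists_density κ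
  have h1 : tvNorm κ = ∫ x, ‖u x‖ ∂κ.variation := by rw [← tvNorm_withDensityᵥ hu, h]
  rw [h1]
  refine integral_norm_le_of_forall hu (norm_nonneg (dual κ)) fun ψ => ?_
  have h2 := cIntegral_withDensityᵥ hu (f := ψ) (by rw [h]; exact integrable_zeroAtInfty _ ψ)
  rw [h] at h2
  rw [← h2, ← dual_apply]
  exact (dual κ).le_opNorm ψ

theorem eq_zero_of_tvNorm {κ : ComplexMeasure X} (h : tvNorm κ = 0) : κ = 0 := by
  ext E _
  have h1 : ‖κ E‖ ≤ 0 := by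
    rw [← h]
    exact (VectorMeasure.norm_measure_le_variation (measure_ne_top _ _)).trans
      (measureReal_mono (Set.subset_univ E) (measure_ne_top _ _))
  simpa using h1

/-- The difference of two regular measures is regular, so its total variation is the norm of the
zero functional. -/
theorem dual_injOn : Set.InjOn (dual (X := X)) (regularMeasures X) := by
  intro κ hκ κ' hκ' h
  have h1 : κ + (-1 : ℂ) • κ' ∈ regularMeasures X := regular_add hκ (regular_smul _ hκ')
  have h2 : dual (κ + (-1 : ℂ) • κ') = 0 := by
    rw [dual_add, dual_smul, h]
    ext ψ
    change dual κ' ψ + -1 * dual κ' ψ = 0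
    ring
  have h3 := eq_zero_of_tvNorm (κ := κ + (-1 : ℂ) • κ') (by
    rw [← norm_dual h1, h2]
    exact ContinuousLinearMap.opNorm_zero)
  ext E _
  have h4 : κ E + -1 * κ' E = 0 := congrArg (fun ρ : ComplexMeasure X => ρ E) h3
  linear_combination h4

theorem represents_iff {Γ : C₀(X, ℂ) →L[ℂ] ℂ} {κ : ComplexMeasure X} :
    Represents Γ κ ↔ κ ∈ regularMeasures X ∧ dual κ = Γ :=
  and_congr_right fun _ => ⟨fun h => ContinuousLinearMap.ext h, fun h ψ => by rw [← h]; rfl⟩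

theorem existsUnique_represents (Γ : C₀(X, ℂ) →L[ℂ] ℂ) : ∃! κ, Represents Γ κ := by
  obtain ⟨κ, hκ, h⟩ := exists_dual_eq Γ
  refine ⟨κ, represents_iff.2 ⟨hκ, h⟩, fun κ' h' => ?_⟩
  have := represents_iff.1 h'
  exact dual_injOn this.1 hκ (this.2.trans h.symm)

theorem rieszMeasure_spec (Γ : C₀(X, ℂ) →L[ℂ] ℂ) :
    rieszMeasure Γ ∈ regularMeasures X ∧ dual (rieszMeasure Γ) = Γ := by
  have h : ∃ κ, Represents Γ κ := (existsUnique_represents Γ).exists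
  rw [rieszMeasure, dif_pos h]
  exact represents_iff.1 h.choose_spec

end RieszRepresentation

/-! ### Functionals with `L¹` densities, induction on functionals, tightness -/

section Density

variable {X : Type*} [TopologicalSpace X] [MeasurableSpace X] [BorelSpace X]

/-- The functional `ψ ↦ ∫ ψ φ dp` for an integrable function `φ`. -/
def densityDual (p : Measure X) (φ : Lp ℂ 1 p) : C₀(X, ℂ) →L[ℂ] ℂ :=
  have hi : ∀ ψ : C₀(X, ℂ), Integrable (fun x => ψ x * φ x) p := fun ψ =>
    (L1.integrable_coeFn φ).bdd_mul ψ.continuous.aestronglyMeasurable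
      (ae_of_all _ (norm_apply_le ψ))
  LinearMap.mkContinuous
    { toFun := fun ψ => ∫ x, ψ x * φ x ∂p
      map_add' := fun ψ ψ' => by
        simp only [ZeroAtInftyContinuousMap.coe_add, Pi.add_apply, add_mul]
        exact integral_add (hi ψ) (hi ψ')
      map_smul' := fun c ψ => by
        simp only [ZeroAtInftyContinuousMap.coe_smul, Pi.smul_apply, smul_eq_mul, mul_assoc,
          RingHom.id_apply]
        exact integral_const_mul _ _ } ‖φ‖ fun ψ => by
      rw [L1.norm_eq_integral_norm, ← integral_mul_const]
      refine (norm_integral_le_integral_norm _).trans (integral_mono (hi ψ).norm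
        ((L1.integrable_coeFn φ).norm.mul_const _) fun x => ?_)
      change ‖ψ x * φ x‖ ≤ ‖φ x‖ * ‖ψ‖
      rw [norm_mul, mul_comm]
      exact mul_le_mul_of_nonneg_left (norm_apply_le ψ x) (norm_nonneg _)

theorem densityDual_apply (p : Measure X) (φ : Lp ℂ 1 p) (ψ : C₀(X, ℂ)) :
    densityDual p φ ψ = ∫ x, ψ x * φ x ∂p := rfl

theorem densityDual_apply_of_ae (p : Measure X) {φ : Lp ℂ 1 p} {f : X → ℂ} (h : φ =ᵐ[p] f)
    (ψ : C₀(X, ℂ)) : densityDual p φ ψ = ∫ x, ψ x * f x ∂p := by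
  rw [densityDual_apply]
  exact integral_congr_ae (h.mono fun x hx => by simp [hx])

theorem densityDual_add (p : Measure X) (φ φ' : Lp ℂ 1 p) :
    densityDual p (φ + φ') = densityDual p φ + densityDual p φ' := by
  ext ψ
  rw [add_apply, densityDual_apply_of_ae p (Lp.coeFn_add φ φ'), densityDual_apply,
    densityDual_apply, ← integral_add]
  · simp only [Pi.add_apply, mul_add]
  all_goals
    exact (L1.integrable_coeFn _).bdd_mul ψ.continuous.aestronglyMeasurable
      (ae_of_all _ (norm_apply_le ψ))

theorem densityDual_smul (p : Measure X) (c : ℂ) (φ : Lp ℂ 1 p) :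
    densityDual p (c • φ) = c • densityDual p φ := by
  ext ψ
  rw [smul_apply, densityDual_apply_of_ae p (Lp.coeFn_smul c φ), densityDual_apply,
    smul_eq_mul, ← integral_const_mul]
  simp only [Pi.smul_apply, smul_eq_mul, mul_left_comm]

variable [T2Space X] [LocallyCompactSpace X]

theorem norm_densityDual (p : Measure X) [p.Regular] (φ : Lp ℂ 1 p) : ‖densityDual p φ‖ = ‖φ‖ := by
  refine le_antisymm (by
    unfold densityDual
    exact LinearMap.mkContinuous_norm_le _ (norm_nonneg φ) _) ?_
  rw [L1.norm_eq_integral_norm]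
  exact integral_norm_le_of_forall (L1.integrable_coeFn φ) (norm_nonneg (densityDual p φ))
    (densityDual p φ).le_opNorm

/-- `φ ↦ φ dp` as an isometry from `L¹(p)` into the dual of `C₀(X)`. -/
def densityIsometry (p : Measure X) [p.Regular] : Lp ℂ 1 p →ₗᵢ[ℂ] (C₀(X, ℂ) →L[ℂ] ℂ) where
  toFun := densityDual p
  map_add' := densityDual_add p
  map_smul' := densityDual_smul p
  norm_map' := norm_densityDual p

/-- The classes of continuous functions with compact support are dense in `L¹(p)`. -/
theorem dense_compactSupport (p : Measure X) [p.Regular] :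
    Dense {φ : Lp ℂ 1 p | ∃ f : C_c(X, ℂ), φ =ᵐ[p] f} := by
  intro φ
  rw [Metric.mem_closure_iff]
  intro ε hε
  obtain ⟨g, hgc, hgε, hg⟩ := exists_compactSupport_integral_norm_sub_le (L1.integrable_coeFn φ)
    (half_pos hε)
  have hi : Integrable g p := hg.integrable_of_hasCompactSupport hgc
  refine ⟨hi.toL1 g, ⟨⟨⟨g, hg⟩, hgc⟩, hi.coeFn_toL1⟩, ?_⟩
  rw [dist_eq_norm, L1.norm_eq_integral_norm]
  refine lt_of_le_of_lt (le_of_eq ?_) (hgε.trans_lt (half_lt_self hε))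
  refine integral_congr_ae ?_
  filter_upwards [Lp.coeFn_sub φ (hi.toL1 g), hi.coeFn_toL1] with x h1 h2
  rw [h1, Pi.sub_apply, h2]

/-- Closed properties of functionals on `C₀(X)` need to be checked only for functionals given by
continuous densities with compact support. -/
theorem functional_induction {P : (C₀(X, ℂ) →L[ℂ] ℂ) → Prop} (hP : IsClosed {Λ | P Λ})
    (h : ∀ (p : Measure X) [IsFiniteMeasure p] [p.Regular] (φ : Lp ℂ 1 p) (f : C_c(X, ℂ)),
      φ =ᵐ[p] f → P (densityDual p φ)) (Λ : C₀(X, ℂ) →L[ℂ] ℂ) : P Λ := by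
  obtain ⟨κ, hκ, rfl⟩ := exists_dual_eq Λ
  have : κ.variation.Regular := hκ
  obtain ⟨u, hu, h1⟩ := exists_density κ
  -- Every functional has an `L¹` density for its own variation, a finite regular measure; that
  -- density is then approximated in `L¹`.
  have h2 : dual κ = densityDual κ.variation (hu.toL1 u) := by
    ext ψ
    rw [densityDual_apply_of_ae _ hu.coeFn_toL1, dual_apply]
    have h2 := cIntegral_withDensityᵥ hu (f := ψ) (by rw [h1]; exact integrable_zeroAtInfty _ ψ)
    rwa [h1] at h2
  rw [h2]
  have h3 : IsClosed {φ : Lp ℂ 1 κ.variation | P (densityDual κ.variation φ)} :=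
    hP.preimage (densityIsometry κ.variation).continuous
  have h4 : {φ : Lp ℂ 1 κ.variation | ∃ f : C_c(X, ℂ), φ =ᵐ[κ.variation] f} ⊆ _ :=
    fun φ ⟨f, hf⟩ => (h κ.variation φ f hf : φ ∈ {φ | P (densityDual κ.variation φ)})
  exact h3.closure_subset_iff.2 h4 (dense_compactSupport κ.variation _)

/-- Bounded functionals on `C₀(X)` are tight. -/
theorem exists_isCompact_norm_le (Λ : C₀(X, ℂ) →L[ℂ] ℂ) {ε : ℝ} (hε : 0 < ε) :
    ∃ K : Set X, IsCompact K ∧ ∃ C : ℝ, 0 ≤ C ∧ ∀ (f : C₀(X, ℂ)) (δ : ℝ), 0 ≤ δ →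
      (∀ x ∈ K, ‖f x‖ ≤ δ) → ‖Λ f‖ ≤ C * δ + ε * ‖f‖ := by
  revert ε
  refine functional_induction (P := fun Λ => ∀ {ε : ℝ}, 0 < ε → ∃ K : Set X, IsCompact K ∧
    ∃ C : ℝ, 0 ≤ C ∧ ∀ (f : C₀(X, ℂ)) (δ : ℝ), 0 ≤ δ →
      (∀ x ∈ K, ‖f x‖ ≤ δ) → ‖Λ f‖ ≤ C * δ + ε * ‖f‖) ?_ ?_ Λ
  -- Tightness survives norm limits: half of `ε` pays for replacing `Λ` by a nearby tight
  -- functional.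
  · refine isClosed_of_closure_subset fun Λ hΛ ε hε => ?_
    obtain ⟨Λ', h1, h2⟩ := Metric.mem_closure_iff.1 hΛ (ε / 2) (half_pos hε)
    obtain ⟨K, hK, C, hC, h3⟩ := h1 (half_pos hε)
    refine ⟨K, hK, C, hC, fun f δ hδ hf => ?_⟩
    have h4 := h3 f δ hδ hf
    have h5 : ‖Λ f - Λ' f‖ ≤ ε / 2 * ‖f‖ := by
      rw [dist_eq_norm] at h2
      exact ((Λ - Λ').le_opNorm f).trans (mul_le_mul_of_nonneg_right h2.le (norm_nonneg _))
    have h6 : ‖Λ f‖ ≤ ‖Λ f - Λ' f‖ + ‖Λ' f‖ := by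
      simpa using norm_add_le (Λ f - Λ' f) (Λ' f)
    linarith
  · intro p _ _ φ g hφ ε hε
    -- For a compactly supported density the `ε` term is not needed.
    refine ⟨tsupport g, g.hasCompactSupport, ∫ x, ‖g x‖ ∂p, integral_nonneg fun _ => norm_nonneg _,
      fun f δ hδ hf => ?_⟩
    have hg : Integrable g p := g.continuous.integrable_of_hasCompactSupport g.hasCompactSupport
    rw [densityDual_apply_of_ae p hφ, ← integral_mul_const]
    have h1 : ‖∫ x, f x * g x ∂p‖ ≤ ∫ x, ‖g x‖ * δ ∂p := by
      refine norm_integral_le_of_norm_le (hg.norm.mul_const _) (ae_of_all _ fun x => ?_)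
      rw [norm_mul, mul_comm]
      by_cases hx : x ∈ tsupport g
      · exact mul_le_mul_of_nonneg_left (hf x hx) (norm_nonneg _)
      · simp [image_eq_zero_of_notMem_tsupport hx]
    linarith [mul_nonneg hε.le (norm_nonneg f)]

end Density

/-! ### The Banach `*`-algebra structure on the dual of `C₀(G)` -/

section Group

variable {G : Type*} [Group G] [TopologicalSpace G] [IsTopologicalGroup G]

/-- The right translate `x ↦ ψ (x y)`. -/
def rightTranslate (y : G) (ψ : C₀(G, ℂ)) : C₀(G, ℂ) :=
  ψ.comp (Homeomorph.mulRight y).toCocompactMap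

theorem rightTranslate_apply (y : G) (ψ : C₀(G, ℂ)) (x : G) :
    rightTranslate y ψ x = ψ (x * y) := rfl

theorem norm_rightTranslate_le (y : G) (ψ : C₀(G, ℂ)) : ‖rightTranslate y ψ‖ ≤ ‖ψ‖ :=
  norm_zeroAtInfty_le _ (norm_nonneg _) fun x => norm_apply_le ψ (x * y)

/-- Uniform continuity for the left uniform structure is what is needed: `(x y)⁻¹ (x y₀) = y⁻¹ y₀`
does not depend on `x`. -/
theorem continuous_rightTranslate (ψ : C₀(G, ℂ)) : Continuous fun y => rightTranslate y ψ := by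
  let := IsTopologicalGroup.leftUniformSpace G
  have h : UniformContinuous ψ := ZeroAtInftyContinuousMap.uniformContinuous ψ
  rw [continuous_iff_continuousAt]
  intro y₀
  rw [ContinuousAt, Metric.tendsto_nhds]
  intro ε hε
  obtain ⟨t, ht, h1⟩ := mem_comap.1 (h (Metric.dist_mem_uniformity (half_pos hε)))
  have h2 : Tendsto (fun y => y⁻¹ * y₀) (𝓝 y₀) (𝓝 1) := by
    have : Continuous fun y => y⁻¹ * y₀ := by fun_prop
    simpa using this.tendsto y₀
  filter_upwards [h2 ht] with y hy
  rw [dist_eq_norm]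
  refine (norm_zeroAtInfty_le _ (half_pos hε).le fun x => ?_).trans_lt (half_lt_self hε)
  have h3 : (x * y)⁻¹ * (x * y₀) ∈ t := by
    rw [mul_inv_rev, mul_assoc, inv_mul_cancel_left]
    exact hy
  have h4 : dist (ψ (x * y)) (ψ (x * y₀)) < ε / 2 :=
    h1 (show (x * y, x * y₀) ∈ _ from h3)
  rw [dist_eq_norm] at h4
  exact h4.le

/-- The function `x ↦ conj (ψ x⁻¹)`. -/
def flip (ψ : C₀(G, ℂ)) : C₀(G, ℂ) := star (ψ.comp (Homeomorph.inv G).toCocompactMap)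

theorem flip_apply (ψ : C₀(G, ℂ)) (x : G) : flip ψ x = starRingEnd ℂ (ψ x⁻¹) := rfl

theorem flip_flip (ψ : C₀(G, ℂ)) : flip (flip ψ) = ψ := by
  ext x
  simp [flip_apply]

theorem flip_add (ψ ψ' : C₀(G, ℂ)) : flip (ψ + ψ') = flip ψ + flip ψ' := by
  ext x
  simp [flip_apply]

theorem flip_smul (c : ℂ) (ψ : C₀(G, ℂ)) : flip (c • ψ) = starRingEnd ℂ c • flip ψ := by
  ext x
  simp [flip_apply]

theorem norm_flip_le (ψ : C₀(G, ℂ)) : ‖flip ψ‖ ≤ ‖ψ‖ :=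
  norm_zeroAtInfty_le _ (norm_nonneg _) fun x => by
    rw [flip_apply, RCLike.norm_conj]
    exact norm_apply_le ψ _

/-- The involution `Λ^*(ψ) = conj Λ(x ↦ conj ψ(x⁻¹))` on the dual of `C₀(G)`. -/
def starDual (Λ : C₀(G, ℂ) →L[ℂ] ℂ) : C₀(G, ℂ) →L[ℂ] ℂ :=
  LinearMap.mkContinuous
    { toFun := fun ψ => starRingEnd ℂ (Λ (flip ψ))
      map_add' := fun ψ ψ' => by simp [flip_add]
      map_smul' := fun c ψ => by simp [flip_smul] } ‖Λ‖ fun ψ => by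
      change ‖starRingEnd ℂ (Λ (flip ψ))‖ ≤ _
      rw [RCLike.norm_conj]
      exact Λ.le_opNorm_of_le (norm_flip_le ψ)

theorem starDual_apply (Λ : C₀(G, ℂ) →L[ℂ] ℂ) (ψ : C₀(G, ℂ)) :
    starDual Λ ψ = starRingEnd ℂ (Λ (flip ψ)) := rfl

theorem starDual_starDual (Λ : C₀(G, ℂ) →L[ℂ] ℂ) : starDual (starDual Λ) = Λ := by
  ext ψ
  simp [starDual_apply, flip_flip]

theorem starDual_add (Λ Λ' : C₀(G, ℂ) →L[ℂ] ℂ) :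
    starDual (Λ + Λ') = starDual Λ + starDual Λ' := by
  ext ψ
  simp [starDual_apply]

theorem starDual_smul (c : ℂ) (Λ : C₀(G, ℂ) →L[ℂ] ℂ) :
    starDual (c • Λ) = starRingEnd ℂ c • starDual Λ := by
  ext ψ
  simp [starDual_apply]

theorem norm_starDual_le (Λ : C₀(G, ℂ) →L[ℂ] ℂ) : ‖starDual Λ‖ ≤ ‖Λ‖ := by
  unfold starDual
  exact LinearMap.mkContinuous_norm_le _ (norm_nonneg Λ) _

theorem norm_starDual (Λ : C₀(G, ℂ) →L[ℂ] ℂ) : ‖starDual Λ‖ = ‖Λ‖ :=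
  le_antisymm (norm_starDual_le Λ) (by
    simpa only [starDual_starDual] using norm_starDual_le (starDual Λ))

theorem continuous_starDual : Continuous (starDual (G := G)) := by
  refine Isometry.continuous (Isometry.of_dist_eq fun Λ Λ' => ?_)
  rw [dist_eq_norm, dist_eq_norm, ← norm_starDual (Λ - Λ')]
  congr 1
  ext ψ
  simp [starDual_apply]

variable [LocallyCompactSpace G] [T2Space G] [MeasurableSpace G] [BorelSpace G]

/-- Tightness gives a compact `K` carrying most of `Λ`, and `ψ` is small off a compact `L`. If `y ∉
K⁻¹L`, then `K y` misses `L`, so the translate is small on `K`. This is what makes slices vanish at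
infinity. -/
theorem tendsto_rightTranslate (Λ : C₀(G, ℂ) →L[ℂ] ℂ) (ψ : C₀(G, ℂ)) :
    Tendsto (fun y => Λ (rightTranslate y ψ)) (cocompact G) (𝓝 0) := by
  rw [Metric.tendsto_nhds]
  intro ε hε
  obtain ⟨K, hK, C, hC, h⟩ := exists_isCompact_norm_le Λ (ε := ε / (3 * (‖ψ‖ + 1))) (by positivity)
  have hδ : 0 < ε / (3 * (C + 1)) := by positivity
  have h1 : ∀ᶠ x in cocompact G, ‖ψ x‖ < ε / (3 * (C + 1)) := by
    have := (ψ.zero_at_infty').norm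
    rw [norm_zero] at this
    exact this.eventually_lt_const hδ
  obtain ⟨L, hL, hLε⟩ := mem_cocompact.1 h1
  refine mem_cocompact.2 ⟨(fun z : G × G => z.1⁻¹ * z.2) '' (K ×ˢ L),
    (hK.prod hL).image (by fun_prop), fun y hy => ?_⟩
  change dist _ _ < ε
  rw [dist_zero_right]
  refine (h _ _ hδ.le fun x hx => ?_).trans_lt ?_
  · rw [rightTranslate_apply]
    have : x * y ∈ Lᶜ := fun hxy => hy
      ⟨(x, x * y), ⟨hx, hxy⟩, by simp⟩
    exact (hLε this : ‖ψ (x * y)‖ < _).le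
  · have h2 : ε / (3 * (‖ψ‖ + 1)) * ‖rightTranslate y ψ‖ ≤ ε / 3 := by
      rw [div_mul_eq_mul_div, div_le_div_iff₀ (by positivity) (by positivity)]
      nlinarith [norm_rightTranslate_le y ψ, norm_nonneg ψ]
    have h3 : C * (ε / (3 * (C + 1))) ≤ ε / 3 := by
      rw [mul_div_assoc', div_le_div_iff₀ (by positivity) (by positivity)]
      nlinarith
    linarith

/-- The operator `ψ ↦ (y ↦ Λ (x ↦ ψ (x y)))` on `C₀(G)`. -/
def slice (Λ : C₀(G, ℂ) →L[ℂ] ℂ) : C₀(G, ℂ) →L[ℂ] C₀(G, ℂ) :=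
  LinearMap.mkContinuous
    { toFun := fun ψ => ⟨⟨fun y => Λ (rightTranslate y ψ),
        Λ.continuous.comp (continuous_rightTranslate ψ)⟩, tendsto_rightTranslate Λ ψ⟩
      map_add' := fun ψ ψ' => by
        ext y
        exact Λ.map_add (rightTranslate y ψ) (rightTranslate y ψ')
      map_smul' := fun c ψ => by
        ext y
        exact Λ.map_smul c (rightTranslate y ψ) } ‖Λ‖ fun ψ =>
      norm_zeroAtInfty_le _ (mul_nonneg (norm_nonneg _) (norm_nonneg _)) fun y =>
        Λ.le_opNorm_of_le (norm_rightTranslate_le y ψ)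

theorem slice_apply (Λ : C₀(G, ℂ) →L[ℂ] ℂ) (ψ : C₀(G, ℂ)) (y : G) :
    slice Λ ψ y = Λ (rightTranslate y ψ) := rfl

theorem norm_slice_le (Λ : C₀(G, ℂ) →L[ℂ] ℂ) : ‖slice Λ‖ ≤ ‖Λ‖ := by
  unfold slice
  exact LinearMap.mkContinuous_norm_le _ (norm_nonneg Λ) _

/-- The convolution `(Λ ⋆ Λ') ψ = Λ'_y Λ_x ψ(xy)` on the dual of `C₀(G)`. -/
def convDual (Λ Λ' : C₀(G, ℂ) →L[ℂ] ℂ) : C₀(G, ℂ) →L[ℂ] ℂ := Λ'.comp (slice Λ)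

theorem convDual_apply (Λ Λ' : C₀(G, ℂ) →L[ℂ] ℂ) (ψ : C₀(G, ℂ)) :
    convDual Λ Λ' ψ = Λ' (slice Λ ψ) := rfl

theorem convDual_add_left (Λ₁ Λ₂ Λ' : C₀(G, ℂ) →L[ℂ] ℂ) :
    convDual (Λ₁ + Λ₂) Λ' = convDual Λ₁ Λ' + convDual Λ₂ Λ' := by
  ext ψ
  exact Λ'.map_add (slice Λ₁ ψ) (slice Λ₂ ψ)

theorem convDual_smul_left (c : ℂ) (Λ Λ' : C₀(G, ℂ) →L[ℂ] ℂ) :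
    convDual (c • Λ) Λ' = c • convDual Λ Λ' := by
  ext ψ
  exact Λ'.map_smul c (slice Λ ψ)

theorem norm_convDual_le (Λ Λ' : C₀(G, ℂ) →L[ℂ] ℂ) : ‖convDual Λ Λ'‖ ≤ ‖Λ‖ * ‖Λ'‖ := by
  rw [mul_comm]
  exact (Λ'.opNorm_comp_le (slice Λ)).trans
    (mul_le_mul_of_nonneg_left (norm_slice_le Λ) (norm_nonneg _))

/-- The convolution as a bounded bilinear map. -/
def convDualCLM : (C₀(G, ℂ) →L[ℂ] ℂ) →L[ℂ] (C₀(G, ℂ) →L[ℂ] ℂ) →L[ℂ] (C₀(G, ℂ) →L[ℂ] ℂ) :=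
  LinearMap.mkContinuous₂
    (LinearMap.mk₂ ℂ convDual convDual_add_left convDual_smul_left
      (fun _ _ _ => rfl) (fun _ _ _ => rfl)) 1 fun Λ Λ' => by
      rw [one_mul]
      exact norm_convDual_le Λ Λ'

theorem convDualCLM_apply (Λ Λ' : C₀(G, ℂ) →L[ℂ] ℂ) : convDualCLM Λ Λ' = convDual Λ Λ' := rfl

/-- Translating by `z` and then by `y` is translating by `y z`. Associativity of convolution thereby
reduces to that of composition. -/
theorem slice_convDual (Λ Λ' : C₀(G, ℂ) →L[ℂ] ℂ) :
    slice (convDual Λ Λ') = (slice Λ').comp (slice Λ) := by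
  ext ψ z
  change Λ' (slice Λ (rightTranslate z ψ)) = Λ' (rightTranslate z (slice Λ ψ))
  congr 1
  ext y
  change Λ (rightTranslate y (rightTranslate z ψ)) = Λ (rightTranslate (y * z) ψ)
  congr 1
  ext x
  simp [rightTranslate_apply, mul_assoc]

theorem convDual_assoc (Λ₁ Λ₂ Λ₃ : C₀(G, ℂ) →L[ℂ] ℂ) :
    convDual (convDual Λ₁ Λ₂) Λ₃ = convDual Λ₁ (convDual Λ₂ Λ₃) := by
  rw [convDual, slice_convDual]
  rfl

/-- The operator `ψ ↦ (x ↦ Λ (y ↦ ψ (x y)))` on `C₀(G)`. -/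
def leftSlice (Λ : C₀(G, ℂ) →L[ℂ] ℂ) (ψ : C₀(G, ℂ)) : C₀(G, ℂ) :=
  flip (slice (starDual Λ) (flip ψ))

/-- Obtaining the left slice from `slice` by inversion gives continuity and decay for free; here the
conjugations cancel. -/
theorem leftSlice_apply (Λ : C₀(G, ℂ) →L[ℂ] ℂ) (ψ ℓ : C₀(G, ℂ)) (x : G)
    (h : ∀ y, ℓ y = ψ (x * y)) : leftSlice Λ ψ x = Λ ℓ := by
  change starRingEnd ℂ (starRingEnd ℂ (Λ (flip (rightTranslate x⁻¹ (flip ψ))))) = _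
  rw [Complex.conj_conj]
  congr 1
  ext y
  simp [flip_apply, rightTranslate_apply, h]

/-- **Fubini's theorem** for bounded functionals. -/
theorem convDual_apply' (Λ Λ' : C₀(G, ℂ) →L[ℂ] ℂ) (ψ : C₀(G, ℂ)) :
    convDual Λ Λ' ψ = Λ (leftSlice Λ' ψ) := by
  have c1 : ∀ Λ₀ : C₀(G, ℂ) →L[ℂ] ℂ, Continuous fun Λ => convDual Λ Λ₀ ψ := fun Λ₀ =>
    (ContinuousLinearMap.apply ℂ ℂ ψ).continuous.comp (convDualCLM.flip Λ₀).continuous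
  have c2 : ∀ Λ₀ : C₀(G, ℂ) →L[ℂ] ℂ, Continuous fun Λ => convDual Λ₀ Λ ψ := fun Λ₀ =>
    (ContinuousLinearMap.apply ℂ ℂ ψ).continuous.comp (convDualCLM Λ₀).continuous
  have c3 : ∀ f : C₀(G, ℂ), Continuous fun Λ : C₀(G, ℂ) →L[ℂ] ℂ => Λ f := fun f =>
    (ContinuousLinearMap.apply ℂ ℂ f).continuous
  -- Continuity in the functional being sliced is obtained by rewriting the value as a starred
  -- convolution, continuous by boundedness of `convDualCLM`.
  have c4 : ∀ Λ₀ : C₀(G, ℂ) →L[ℂ] ℂ, Continuous fun Λ => Λ₀ (leftSlice Λ ψ) := by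
    intro Λ₀
    have h1 : ∀ Λ, Λ₀ (leftSlice Λ ψ) =
        starDual (convDualCLM (starDual Λ) (starDual Λ₀)) ψ := fun Λ => by
      rw [starDual_apply, convDualCLM_apply, convDual_apply, starDual_apply, Complex.conj_conj]
      rfl
    simp only [h1]
    exact (c3 ψ).comp (continuous_starDual.comp
      ((convDualCLM.flip (starDual Λ₀)).continuous.comp continuous_starDual))
  refine functional_induction (P := fun Λ => convDual Λ Λ' ψ = Λ (leftSlice Λ' ψ))
    (isClosed_eq (c1 _) (c3 _)) (fun p _ _ φ f hφ => ?_) Λ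
  refine functional_induction (P := fun Λ' => convDual (densityDual p φ) Λ' ψ =
    densityDual p φ (leftSlice Λ' ψ)) (isClosed_eq (c2 _) (c4 _)) (fun p' _ _ φ' f' hφ' => ?_) Λ'
  have e1 : ∀ y, slice (densityDual p φ) ψ y = ∫ x, ψ (x * y) * f x ∂p := fun y => by
    rw [slice_apply, densityDual_apply_of_ae p hφ]
    rfl
  have e2 : ∀ x, leftSlice (densityDual p' φ') ψ x = ∫ y, ψ (x * y) * f' y ∂p' := fun x => by
    rw [leftSlice_apply _ _ (ψ.comp (Homeomorph.mulLeft x).toCocompactMap) x fun _ => rfl,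
      densityDual_apply_of_ae p' hφ']
    rfl
  rw [convDual_apply, densityDual_apply_of_ae p' hφ', densityDual_apply_of_ae p hφ]
  simp only [e1, e2, ← integral_mul_const]
  -- With continuous compactly supported densities the integrand is continuous with compact support,
  -- so the swap needs no measurability on the product.
  rw [integral_integral_swap_of_hasCompactSupport]
  · simp only [mul_right_comm]
  · simp only [Function.uncurry_def]
    fun_prop
  · refine HasCompactSupport.intro (f'.hasCompactSupport.isCompact.prod
      f.hasCompactSupport.isCompact) fun z hz => ?_
    rw [Set.mem_prod, not_and_or] at hz
    rcases hz with hz | hz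
    · simp [Function.uncurry_def, image_eq_zero_of_notMem_tsupport hz]
    · simp [Function.uncurry_def, image_eq_zero_of_notMem_tsupport hz]

/-- Since `(x y)⁻¹ = y⁻¹ x⁻¹`, inversion exchanges the order of the variables, and Fubini's theorem
restores it. -/
theorem starDual_convDual (Λ Λ' : C₀(G, ℂ) →L[ℂ] ℂ) :
    starDual (convDual Λ Λ') = convDual (starDual Λ') (starDual Λ) := by
  ext ψ
  rw [starDual_apply, convDual_apply']
  change _ = starRingEnd ℂ (Λ (flip (slice (starDual Λ') ψ)))
  rw [leftSlice, flip_flip]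

end Group

/-! ### Topology of the coset space -/

section CosetTopology

variable {G : Type*} [Group G] [TopologicalSpace G] [IsTopologicalGroup G] (H : Subgroup G)

theorem isOpenQuotientMap_mk : IsOpenQuotientMap (CosetSpace.mk H) :=
  QuotientGroup.isOpenQuotientMap_mk

theorem continuous_mk : Continuous (CosetSpace.mk H) := (isOpenQuotientMap_mk H).continuous

theorem mk_surjective : Function.Surjective (CosetSpace.mk H) := (isOpenQuotientMap_mk H).surjective

omit [TopologicalSpace G] [IsTopologicalGroup G] in
theorem smul_mk (g x : G) : g • CosetSpace.mk H x = CosetSpace.mk H (g * x) := rfl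

omit [TopologicalSpace G] [IsTopologicalGroup G] in
theorem mk_mul (x : G) (h : H) : CosetSpace.mk H (x * h) = CosetSpace.mk H x :=
  QuotientGroup.mk_mul_of_mem x h.2

omit [TopologicalSpace G] [IsTopologicalGroup G] in
theorem exists_rep_mk (x : G) : ∃ h : H, (CosetSpace.mk H x).rep = x * h :=
  QuotientGroup.mk_out_eq_mul H x

instance instContinuousSMulCosetSpace : ContinuousSMul G (CosetSpace H) :=
  inferInstanceAs (ContinuousSMul G (G ⧸ H))

instance instLocallyCompactSpaceCosetSpace [LocallyCompactSpace G] :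
    LocallyCompactSpace (CosetSpace H) :=
  inferInstanceAs (LocallyCompactSpace (G ⧸ H))

instance instT2SpaceCosetSpace [T2Space G] [CompactSpace H] : T2Space (CosetSpace H) :=
  have : IsClosed (H : Set G) := (isCompact_iff_compactSpace.2 inferInstance).isClosed
  inferInstanceAs (T2Space (G ⧸ H))

/-- The quotient map is closed with fibres `gH`, both because `H` is compact. Hence functions
vanishing at infinity pull back to such functions. -/
theorem isProperMap_mk [CompactSpace H] : IsProperMap (CosetSpace.mk H) := by
  have hH : IsCompact (H : Set G) := isCompact_iff_compactSpace.2 inferInstance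
  refine isProperMap_iff_isClosedMap_and_compact_fibers.2
    ⟨continuous_mk H, QuotientGroup.isClosedMap_coe hH, fun x => ?_⟩
  obtain ⟨g, rfl⟩ := mk_surjective H x
  have : CosetSpace.mk H ⁻¹' {CosetSpace.mk H g} = (fun k => g * k) '' (H : Set G) := by
    ext k
    simp only [Set.mem_preimage, Set.mem_singleton_iff, Set.mem_image, SetLike.mem_coe]
    constructor
    · intro h
      exact ⟨g⁻¹ * k, QuotientGroup.eq.1 (Eq.symm h), by simp⟩
    · rintro ⟨h, hh, rfl⟩
      exact mk_mul H g ⟨h, hh⟩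
  rw [this]
  exact hH.image (by fun_prop)

theorem tendsto_mk_cocompact [CompactSpace H] :
    Tendsto (CosetSpace.mk H) (cocompact G) (cocompact (CosetSpace H)) := by
  intro s hs
  obtain ⟨K, hK, h⟩ := mem_cocompact.1 hs
  exact mem_cocompact.2 ⟨_, (isProperMap_mk H).isCompact_preimage hK, fun x hx => h hx⟩

/-- The composition of a function on `G/H` with the canonical map, as a linear map. -/
def pull [CompactSpace H] : C₀(CosetSpace H, ℂ) →L[ℂ] C₀(G, ℂ) :=
  LinearMap.mkContinuous (ZeroAtInftyContinuousMap.compLinearMap (R := ℂ)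
    ⟨⟨CosetSpace.mk H, continuous_mk H⟩, tendsto_mk_cocompact H⟩) 1 fun ψ => by
      rw [one_mul]
      exact norm_zeroAtInfty_le _ (norm_nonneg _) fun x => norm_apply_le ψ _

variable {H}

theorem pull_apply [CompactSpace H] (ψ : C₀(CosetSpace H, ℂ)) (x : G) :
    pull H ψ x = ψ (CosetSpace.mk H x) := rfl

theorem norm_pull_le [CompactSpace H] (ψ : C₀(CosetSpace H, ℂ)) : ‖pull H ψ‖ ≤ ‖ψ‖ :=
  norm_zeroAtInfty_le _ (norm_nonneg _) fun _ => norm_apply_le ψ _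

end CosetTopology

/-! ### Normalized Haar measure of `H` -/

section HaarProb

variable {G : Type*} [Group G] [TopologicalSpace G] [IsTopologicalGroup G] [LocallyCompactSpace G]
  [MeasurableSpace G] [BorelSpace G] (H : Subgroup G) [CompactSpace H]

instance instIsProbabilityMeasureHaarProb : IsProbabilityMeasure (haarProb H) :=
  ⟨by
    simpa [haarProb] using Measure.haarMeasure_self
      (K₀ := (⊤ : TopologicalSpace.PositiveCompacts H))⟩

instance instIsHaarMeasureHaarProb : (haarProb H).IsHaarMeasure := by
  unfold haarProb
  infer_instance

variable {H}

theorem integrable_haarProb {f : H → ℂ} (hf : Continuous f) : Integrable f (haarProb H) :=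
  hf.integrable_of_hasCompactSupport (HasCompactSupport.of_compactSpace f)

/-- Integrate `f (h⁻¹ k)` over `H × H` in both orders; left invariance evaluates one inner integral
as `∫ f(h)` and the other as `∫ f(h⁻¹)`. -/
theorem integral_haarProb_inv {f : H → ℂ} (hf : Continuous f) :
    ∫ h, f h⁻¹ ∂(haarProb H) = ∫ h, f h ∂(haarProb H) := by
  have h1 := integral_integral_swap_of_hasCompactSupport (f := fun h k : H => f (h⁻¹ * k))
    (μ := haarProb H) (ν := haarProb H) (by simp only [Function.uncurry_def]; fun_prop)
    (HasCompactSupport.of_compactSpace _)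
  have h2 : ∀ h : H, ∫ k, f (h⁻¹ * k) ∂(haarProb H) = ∫ h, f h ∂(haarProb H) := fun h =>
    integral_mul_left_eq_self f h⁻¹
  have h3 : ∀ k : H, ∫ h, f (h⁻¹ * k) ∂(haarProb H) = ∫ h, f h⁻¹ ∂(haarProb H) := fun k => by
    rw [← integral_mul_left_eq_self _ k]
    simp
  simp only [h2, h3] at h1
  simpa using h1.symm

end HaarProb

/-! ### Averaging over `H` between `C₀(G)` and `C₀(G/H)` -/

section Average

variable {G : Type*} [Group G] [TopologicalSpace G] [IsTopologicalGroup G] [LocallyCompactSpace G]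
  [MeasurableSpace G] [BorelSpace G] (H : Subgroup G) [CompactSpace H]

/-- The functional `ψ ↦ ∫_H ψ(h) dh` on `C₀(G)`. -/
def haarDual : C₀(G, ℂ) →L[ℂ] ℂ :=
  have hi : ∀ ψ : C₀(G, ℂ), Integrable (fun h : H => ψ h) (haarProb H) := fun ψ =>
    integrable_haarProb (by fun_prop)
  LinearMap.mkContinuous
    { toFun := fun ψ => ∫ h : H, ψ h ∂(haarProb H)
      map_add' := fun ψ ψ' => integral_add (hi ψ) (hi ψ')
      map_smul' := fun c ψ => integral_const_mul c _ } 1 fun ψ => by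
      rw [one_mul]
      refine (norm_integral_le_of_norm_le_const
        (ae_of_all _ fun h : H => norm_apply_le ψ h)).trans ?_
      simp

theorem haarDual_apply (ψ : C₀(G, ℂ)) : haarDual H ψ = ∫ h : H, ψ h ∂(haarProb H) := rfl

theorem starDual_haarDual : starDual (haarDual H) = haarDual H := by
  ext ψ
  rw [starDual_apply, haarDual_apply, ← integral_conj, haarDual_apply,
    ← integral_haarProb_inv (f := fun h : H => ψ (h : G)) (by fun_prop)]
  simp [flip_apply]

variable [T2Space G]

theorem leftSlice_haarDual_apply (f : C₀(G, ℂ)) (x : G) :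
    leftSlice (haarDual H) f x = ∫ h : H, f (x * h) ∂(haarProb H) :=
  leftSlice_apply _ _ (f.comp (Homeomorph.mulLeft x).toCocompactMap) x fun _ => rfl

theorem leftSlice_haarDual_mul (f : C₀(G, ℂ)) (x : G) (k : H) :
    leftSlice (haarDual H) f (x * k) = leftSlice (haarDual H) f x := by
  rw [leftSlice_haarDual_apply, leftSlice_haarDual_apply,
    ← integral_mul_left_eq_self (fun h : H => f (x * h)) k]
  simp [mul_assoc]

theorem leftSlice_haarDual_rep (f : C₀(G, ℂ)) (x : G) :
    leftSlice (haarDual H) f (CosetSpace.mk H x).rep = leftSlice (haarDual H) f x := by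
  obtain ⟨h, hh⟩ := exists_rep_mk H x
  rw [hh, leftSlice_haarDual_mul]

/-- The average `xH ↦ ∫_H f(xh) dh` of a function `f ∈ C₀(G)`. -/
def push (f : C₀(G, ℂ)) : C₀(CosetSpace H, ℂ) where
  toFun x := leftSlice (haarDual H) f x.rep
  continuous_toFun := by
    rw [← (isOpenQuotientMap_mk H).continuous_comp_iff]
    simp only [Function.comp_def, leftSlice_haarDual_rep]
    fun_prop
  zero_at_infty' := by
    intro s hs
    obtain ⟨K, hK, h⟩ := mem_cocompact.1 ((leftSlice (haarDual H) f).zero_at_infty' hs)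
    refine mem_cocompact.2 ⟨CosetSpace.mk H '' K, hK.image (continuous_mk H), fun x hx => ?_⟩
    have : x.rep ∈ Kᶜ := fun h => hx ⟨_, h, CosetSpace.mk_rep x⟩
    exact h this

theorem push_apply (f : C₀(G, ℂ)) (x : CosetSpace H) :
    push H f x = ∫ h : H, f (x.rep * h) ∂(haarProb H) := leftSlice_haarDual_apply H f x.rep

theorem push_mk (f : C₀(G, ℂ)) (x : G) :
    push H f (CosetSpace.mk H x) = ∫ h : H, f (x * h) ∂(haarProb H) :=
  (leftSlice_haarDual_rep H f x).trans (leftSlice_haarDual_apply H f x)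

/-- Together with `push_pull` this realizes `C₀(G/H)` as the range of the right averaging projection
on `C₀(G)`. -/
theorem pull_push (f : C₀(G, ℂ)) : pull H (push H f) = leftSlice (haarDual H) f := by
  ext x
  exact leftSlice_haarDual_rep H f x

theorem push_pull (ψ : C₀(CosetSpace H, ℂ)) : push H (pull H ψ) = ψ := by
  ext x
  rw [push_apply]
  simp [pull_apply, mk_mul, CosetSpace.mk_rep]

theorem norm_push_le (f : C₀(G, ℂ)) : ‖push H f‖ ≤ ‖f‖ :=
  norm_zeroAtInfty_le _ (norm_nonneg _) fun x => by
    rw [push_apply]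
    refine (norm_integral_le_of_norm_le_const
      (ae_of_all _ fun h : H => norm_apply_le f (x.rep * h))).trans ?_
    simp

/-- The averaging map as a bounded operator. -/
def pushCLM : C₀(G, ℂ) →L[ℂ] C₀(CosetSpace H, ℂ) :=
  LinearMap.mkContinuous
    { toFun := push H
      map_add' := fun f g => by
        ext x
        simp only [push_apply, ZeroAtInftyContinuousMap.coe_add, Pi.add_apply]
        exact integral_add (integrable_haarProb (by fun_prop)) (integrable_haarProb (by fun_prop))
      map_smul' := fun c f => by
        ext x
        simp only [push_apply, ZeroAtInftyContinuousMap.coe_smul, Pi.smul_apply, RingHom.id_apply]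
        exact integral_const_mul c _ } 1 fun f => by
      rw [one_mul]
      exact norm_push_le H f

end Average

/-! ### Functionals and measures on `G/H` inside the dual of `C₀(G)` -/

section Lift

variable {G : Type*} [Group G] [TopologicalSpace G] [IsTopologicalGroup G] [LocallyCompactSpace G]
  [T2Space G] [MeasurableSpace G] [BorelSpace G] (H : Subgroup G) [CompactSpace H]

/-- The functional on `C₀(G)` induced by a functional on `C₀(G/H)`. -/
def lift (Λ : C₀(CosetSpace H, ℂ) →L[ℂ] ℂ) : C₀(G, ℂ) →L[ℂ] ℂ := Λ.comp (pushCLM H)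

theorem lift_apply (Λ : C₀(CosetSpace H, ℂ) →L[ℂ] ℂ) (f : C₀(G, ℂ)) :
    lift H Λ f = Λ (push H f) := rfl

theorem lift_pull (Λ : C₀(CosetSpace H, ℂ) →L[ℂ] ℂ) (ψ : C₀(CosetSpace H, ℂ)) :
    lift H Λ (pull H ψ) = Λ ψ := by
  rw [lift_apply, push_pull]

theorem lift_comp_pull (Λ : C₀(CosetSpace H, ℂ) →L[ℂ] ℂ) : (lift H Λ).comp (pull H) = Λ :=
  ContinuousLinearMap.ext (lift_pull H Λ)

theorem lift_injective : Function.Injective (lift H) := fun Λ Λ' h => by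
  rw [← lift_comp_pull H Λ, h, lift_comp_pull]

theorem lift_add (Λ Λ' : C₀(CosetSpace H, ℂ) →L[ℂ] ℂ) :
    lift H (Λ + Λ') = lift H Λ + lift H Λ' := rfl

theorem lift_smul (c : ℂ) (Λ : C₀(CosetSpace H, ℂ) →L[ℂ] ℂ) : lift H (c • Λ) = c • lift H Λ := rfl

/-- `push` and `pull` are contractions and `push ∘ pull` is the identity. -/
theorem norm_lift (Λ : C₀(CosetSpace H, ℂ) →L[ℂ] ℂ) : ‖lift H Λ‖ = ‖Λ‖ := by
  refine le_antisymm (ContinuousLinearMap.opNorm_le_bound _ (norm_nonneg Λ) fun f =>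
    Λ.le_opNorm_of_le (norm_push_le H f)) (ContinuousLinearMap.opNorm_le_bound _
      (norm_nonneg (lift H Λ)) fun ψ => ?_)
  rw [← lift_pull H Λ ψ]
  exact (lift H Λ).le_opNorm_of_le (norm_pull_le ψ)

/-- A lifted functional sees only right averages. With the converse `lift_comp_pull_of_convDual`,
the image of `lift` is the set of functionals fixed by `haarDual` on the right. -/
theorem convDual_lift_haarDual (Λ : C₀(CosetSpace H, ℂ) →L[ℂ] ℂ) :
    convDual (lift H Λ) (haarDual H) = lift H Λ := by
  ext f
  rw [convDual_apply', ← pull_push, lift_pull, lift_apply]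

/-- Functionals fixed by right convolution with `dh` come from `C₀(G/H)`. -/
theorem lift_comp_pull_of_convDual {Λ : C₀(G, ℂ) →L[ℂ] ℂ} (h : convDual Λ (haarDual H) = Λ) :
    lift H (Λ.comp (pull H)) = Λ := by
  ext f
  rw [lift_apply, ContinuousLinearMap.comp_apply, pull_push, ← convDual_apply', h]

/-- The convolution on the dual of `C₀(G/H)`. -/
def cosetConv (Λ Λ' : C₀(CosetSpace H, ℂ) →L[ℂ] ℂ) : C₀(CosetSpace H, ℂ) →L[ℂ] ℂ :=
  (convDual (lift H Λ) (lift H Λ')).comp (pull H)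

/-- By associativity the product inherits the right fixedness of its second factor, so passing to
`G/H` loses nothing. -/
theorem lift_cosetConv (Λ Λ' : C₀(CosetSpace H, ℂ) →L[ℂ] ℂ) :
    lift H (cosetConv H Λ Λ') = convDual (lift H Λ) (lift H Λ') :=
  lift_comp_pull_of_convDual H (by rw [convDual_assoc, convDual_lift_haarDual])

/-- The involution on the dual of `C₀(G/H)`. -/
def cosetStar (Λ : C₀(CosetSpace H, ℂ) →L[ℂ] ℂ) : C₀(CosetSpace H, ℂ) →L[ℂ] ℂ :=
  (starDual (lift H Λ)).comp (pull H)

/-- Invariance of a functional on `C₀(G/H)` under the left action of `H`. -/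
def IsInvariant (Λ : C₀(CosetSpace H, ℂ) →L[ℂ] ℂ) : Prop :=
  convDual (haarDual H) (lift H Λ) = lift H Λ

variable {H}

/-- The involution exchanges left and right fixedness, as `haarDual` is self-adjoint. Invariance on
the left is thus exactly what lets the starred functional descend to `G/H`. -/
theorem lift_cosetStar {Λ : C₀(CosetSpace H, ℂ) →L[ℂ] ℂ} (h : IsInvariant H Λ) :
    lift H (cosetStar H Λ) = starDual (lift H Λ) := by
  refine lift_comp_pull_of_convDual H ?_
  conv_lhs => rw [← starDual_haarDual]
  rw [← starDual_convDual, h]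

theorem isInvariant_cosetConv {Λ Λ' : C₀(CosetSpace H, ℂ) →L[ℂ] ℂ} (h : IsInvariant H Λ) :
    IsInvariant H (cosetConv H Λ Λ') := by
  rw [IsInvariant, lift_cosetConv, ← convDual_assoc, h]

theorem isInvariant_cosetStar {Λ : C₀(CosetSpace H, ℂ) →L[ℂ] ℂ} (h : IsInvariant H Λ) :
    IsInvariant H (cosetStar H Λ) := by
  rw [IsInvariant, lift_cosetStar h]
  conv_lhs => rw [← starDual_haarDual]
  rw [← starDual_convDual, convDual_lift_haarDual]

/-- The translate `x ↦ ψ (g x)`. -/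
def leftTranslate (g : G) (ψ : C₀(CosetSpace H, ℂ)) : C₀(CosetSpace H, ℂ) :=
  ψ.comp (Homeomorph.smul g).toCocompactMap

theorem leftTranslate_apply (g : G) (ψ : C₀(CosetSpace H, ℂ)) (x : CosetSpace H) :
    leftTranslate g ψ x = ψ (g • x) := rfl

/-- Convolution with `haarDual` on the left is the average of the translates of `Λ` over `H`. Such
an average is invariant, by invariance of `dh`, and an invariant functional equals its average,
since `dh` has mass one. -/
theorem isInvariant_iff {Λ : C₀(CosetSpace H, ℂ) →L[ℂ] ℂ} :
    IsInvariant H Λ ↔ ∀ h ∈ H, ∀ ψ : C₀(CosetSpace H, ℂ), Λ (leftTranslate h ψ) = Λ ψ := by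
  have e : ∀ (g : G) (f : C₀(G, ℂ)),
      leftSlice (lift H Λ) f g = Λ (leftTranslate g (push H f)) := fun g f => by
    rw [leftSlice_apply (lift H Λ) f (f.comp (Homeomorph.mulLeft g).toCocompactMap) g fun _ => rfl,
      lift_apply]
    congr 1
    ext x
    obtain ⟨x, rfl⟩ := mk_surjective H x
    rw [leftTranslate_apply, smul_mk, push_mk, push_mk]
    simp only [mul_assoc]
    rfl
  constructor
  · intro h k hk ψ
    have h1 : ∀ g : G, Λ (leftTranslate g ψ) = leftSlice (lift H Λ) (pull H ψ) g := fun g => by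
      rw [e, push_pull]
    have h2 : ∀ φ : C₀(CosetSpace H, ℂ),
        Λ φ = ∫ k : H, Λ (leftTranslate (k : G) φ) ∂(haarProb H) := fun φ => by
      have h3 := DFunLike.congr_fun h (pull H φ)
      rw [convDual_apply', haarDual_apply, lift_pull] at h3
      simp only [e, push_pull] at h3
      exact h3.symm
    rw [h2 ψ, h2 (leftTranslate k ψ)]
    have h4 : ∀ l : H, Λ (leftTranslate (l : G) (leftTranslate k ψ)) =
        leftSlice (lift H Λ) (pull H ψ) ((⟨k, hk⟩ * l : H) : G) := fun l => by
      rw [← h1]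
      congr 1
      ext x
      simp [leftTranslate_apply, mul_smul]
    simp only [h4, h1]
    exact integral_mul_left_eq_self (fun l : H => leftSlice (lift H Λ) (pull H ψ) l) ⟨k, hk⟩
  · intro h
    ext f
    rw [convDual_apply', haarDual_apply]
    simp only [e, lift_apply]
    have h1 : ∀ k : H, Λ (leftTranslate (k : G) (push H f)) = Λ (push H f) := fun k => h k k.2 _
    simp [h1]

/-- The inner average over `H` comes from lifting in the `x` variable. The lift in `y` contributes
nothing, because the slice of a pulled-back function is already constant on cosets. -/
theorem convFunctional_eq (κ κ' : ComplexMeasure (CosetSpace H)) :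
    convFunctional H κ κ' = cosetConv H (dual κ) (dual κ') := by
  ext ψ
  change _ = cIntegral κ' fun y => push H (slice (lift H (dual κ)) (pull H ψ)) y
  refine cIntegral_congr fun y => ?_
  have h1 : ∀ h : H, slice (lift H (dual κ)) (pull H ψ) (y.rep * h) =
      slice (lift H (dual κ)) (pull H ψ) y.rep := fun h => by
    rw [slice_apply, slice_apply]
    congr 1
    ext x
    simp only [rightTranslate_apply, pull_apply, ← mul_assoc, mk_mul]
  rw [push_apply]
  simp only [h1, integral_const, probReal_univ, one_smul]
  rw [slice_apply, lift_apply, dual_apply]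
  refine cIntegral_congr fun x => ?_
  rw [push_apply]
  refine integral_congr_ae (ae_of_all _ fun h => ?_)
  change _ = ψ (CosetSpace.mk H (x.rep * h * y.rep))
  rw [← smul_mk, CosetSpace.mk_rep]

theorem invFunctional_eq (κ : ComplexMeasure (CosetSpace H)) :
    invFunctional H κ = cosetStar H (dual κ) := by
  ext ψ
  have h1 : ∀ x : CosetSpace H, push H (flip (pull H ψ)) x = starRingEnd ℂ
      (∫ h : H, ψ (CosetSpace.mk H ((h : G)⁻¹ * x.rep⁻¹)) ∂(haarProb H)) := fun x => by
    rw [push_apply, ← integral_conj]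
    simp only [flip_apply, pull_apply, mul_inv_rev]
  change _ = starRingEnd ℂ (cIntegral κ fun x => push H (flip (pull H ψ)) x)
  rw [invFunctional, cIntegral_conjMeasure]
  · exact congrArg _ (cIntegral_congr fun x => (h1 x).symm)
  -- The integrand is the conjugate of a function in `C₀(G/H)`, hence integrable.
  · have h2 := (integrable_zeroAtInfty κ.variation (star (push H (flip (pull H ψ)))))
    refine h2.congr (ae_of_all _ fun x => ?_)
    change starRingEnd ℂ (push H (flip (pull H ψ)) x) = _
    rw [h1, Complex.conj_conj]

theorem dual_measConv (κ κ' : ComplexMeasure (CosetSpace H)) :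
    measConv H κ κ' ∈ regularMeasures (CosetSpace H) ∧
      dual (measConv H κ κ') = cosetConv H (dual κ) (dual κ') := by
  rw [measConv, convFunctional_eq]
  exact rieszMeasure_spec _

theorem dual_measInv (κ : ComplexMeasure (CosetSpace H)) :
    measInv H κ ∈ regularMeasures (CosetSpace H) ∧
      dual (measInv H κ) = cosetStar H (dual κ) := by
  rw [measInv, invFunctional_eq]
  exact rieszMeasure_spec _

/-- The image of `κ` under translation is regular and represents the translated functional;
uniqueness in Riesz–Markov turns equality of functionals into equality on Borel sets. -/
theorem mem_invariantMeasures_iff {κ : ComplexMeasure (CosetSpace H)} :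
    κ ∈ invariantMeasures H ↔ κ ∈ regularMeasures (CosetSpace H) ∧ IsInvariant H (dual κ) := by
  refine and_congr_right fun hκ => ?_
  rw [isInvariant_iff]
  have hκ' : κ.variation.Regular := hκ
  have hm : ∀ g : G, MeasurableEmbedding fun x : CosetSpace H => g • x := fun g =>
    (Homeomorph.smul g).measurableEmbedding
  have hr : ∀ g : G, κ.map (fun x : CosetSpace H => g • x) ∈ regularMeasures (CosetSpace H) := by
    intro g
    change (VectorMeasure.variation _).Regular
    rw [(hm g).variation_map]
    exact Measure.Regular.map (Homeomorph.smul g)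
  have hd : ∀ (g : G) (ψ : C₀(CosetSpace H, ℂ)),
      dual (κ.map fun x : CosetSpace H => g • x) ψ = dual κ (leftTranslate g ψ) := fun g ψ =>
    (hm g).integral_map_vectorMeasure
  have he : ∀ g : G, (∀ ψ : C₀(CosetSpace H, ℂ), dual κ (leftTranslate g ψ) = dual κ ψ) ↔
      ∀ E : Set (CosetSpace H), MeasurableSet E → κ ((fun x => g • x) ⁻¹' E) = κ E := by
    intro g
    constructor
    · intro h E hE
      have h1 : κ.map (fun x : CosetSpace H => g • x) = κ :=
        dual_injOn (hr g) hκ (ContinuousLinearMap.ext fun ψ => (hd g ψ).trans (h ψ))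
      rw [← VectorMeasure.map_apply κ (hm g).measurable hE, h1]
    · intro h ψ
      have h1 : κ.map (fun x : CosetSpace H => g • x) = κ := by
        ext E hE
        rw [VectorMeasure.map_apply κ (hm g).measurable hE, h E hE]
      rw [← hd, h1]
  constructor
  · intro h g hg
    refine (he g).2 fun E hE => ?_
    -- The image under `g⁻¹` is the preimage under `g`, and `H` is stable under inverses.
    rw [← h g⁻¹ (H.inv_mem hg) E hE, Set.image_smul, ← Set.preimage_smul_inv, inv_inv]
  · intro h g hg E hE
    rw [Set.image_smul, ← Set.preimage_smul_inv]
    exact (he g⁻¹).1 (h g⁻¹ (H.inv_mem hg)) E hE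

end Lift

/-! ### Transfer of Banach `*`-algebra structure along an embedding -/

section Transfer

variable {V W : Type*} [AddCommGroup V] [Module ℂ V] [AddCommGroup W] [Module ℂ W]
  {S : Set V} {nrm : V → ℝ} {mul : V → V → V} {inv : V → V}
  {S' : Set W} {nrm' : W → ℝ} {mul' : W → W → W} {inv' : W → W} {F : V → W}

/-- A subset that embeds isometrically into a Banach `*`-algebra, with closed image, and that is
stable under the operations, is a Banach `*`-algebra. -/
theorem IsIsometricStarEmbedding.isBanachStarAlgebra
    (hF : IsIsometricStarEmbedding S nrm mul inv S' nrm' mul' inv' F)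
    (hS' : IsBanachStarAlgebra S' nrm' mul' inv') (zero_mem : 0 ∈ S)
    (add_mem : ∀ a ∈ S, ∀ b ∈ S, a + b ∈ S) (smul_mem : ∀ (c : ℂ), ∀ a ∈ S, c • a ∈ S)
    (mul_mem : ∀ a ∈ S, ∀ b ∈ S, mul a b ∈ S) (inv_mem : ∀ a ∈ S, inv a ∈ S)
    (closed : ∀ (u : ℕ → V) (b : W), (∀ n, u n ∈ S) → b ∈ S' →
      Tendsto (fun n => nrm' (F (u n) - b)) atTop (𝓝 0) → ∃ a ∈ S, F a = b) :
    IsBanachStarAlgebra S nrm mul inv := by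
  have map_zero : F 0 = 0 := by simpa using hF.map_smul 0 0 zero_mem
  have sub_eq : ∀ a b : V, a - b = a + (-1 : ℂ) • b := fun a b => by
    rw [neg_one_smul, sub_eq_add_neg]
  have sub_mem : ∀ a ∈ S, ∀ b ∈ S, a - b ∈ S := fun a ha b hb => by
    rw [sub_eq]
    exact add_mem a ha _ (smul_mem _ b hb)
  have map_sub : ∀ a ∈ S, ∀ b ∈ S, F (a - b) = F a - F b := fun a ha b hb => by
    rw [sub_eq, hF.map_add a ha _ (smul_mem _ b hb), hF.map_smul _ b hb, neg_one_smul,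
      sub_eq_add_neg]
  have hm : ∀ a ∈ S, F a ∈ S' := hF.mapsTo
  refine
    { zero_mem := zero_mem
      add_mem := add_mem
      smul_mem := smul_mem
      mul_mem := mul_mem
      inv_mem := inv_mem
      norm_nonneg := fun a ha => hF.map_norm a ha ▸ hS'.norm_nonneg _ (hm a ha)
      norm_eq_zero := fun a ha => ?_
      norm_add_le := fun a ha b hb => ?_
      norm_smul := fun c a ha => ?_
      complete := fun u hu hc => ?_
      add_mul := fun a ha b hb c hc => hF.injOn (mul_mem _ (add_mem a ha b hb) c hc)
        (add_mem _ (mul_mem a ha c hc) _ (mul_mem b hb c hc)) ?_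
      mul_add := fun a ha b hb c hc => hF.injOn (mul_mem a ha _ (add_mem b hb c hc))
        (add_mem _ (mul_mem a ha b hb) _ (mul_mem a ha c hc)) ?_
      smul_mul := fun c a ha b hb => hF.injOn (mul_mem _ (smul_mem c a ha) b hb)
        (smul_mem c _ (mul_mem a ha b hb)) ?_
      mul_smul := fun c a ha b hb => hF.injOn (mul_mem a ha _ (smul_mem c b hb))
        (smul_mem c _ (mul_mem a ha b hb)) ?_
      mul_assoc := fun a ha b hb c hc => hF.injOn (mul_mem _ (mul_mem a ha b hb) c hc)
        (mul_mem a ha _ (mul_mem b hb c hc)) ?_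
      norm_mul_le := fun a ha b hb => ?_
      inv_add := fun a ha b hb => hF.injOn (inv_mem _ (add_mem a ha b hb))
        (add_mem _ (inv_mem a ha) _ (inv_mem b hb)) ?_
      inv_smul := fun c a ha => hF.injOn (inv_mem _ (smul_mem c a ha))
        (smul_mem _ _ (inv_mem a ha)) ?_
      inv_inv := fun a ha => hF.injOn (inv_mem _ (inv_mem a ha)) ha ?_
      inv_mul := fun a ha b hb => hF.injOn (inv_mem _ (mul_mem a ha b hb))
        (mul_mem _ (inv_mem b hb) _ (inv_mem a ha)) ?_
      norm_inv := fun a ha => ?_ }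
  · rw [← hF.map_norm a ha, hS'.norm_eq_zero _ (hm a ha)]
    exact ⟨fun h => hF.injOn ha zero_mem (h.trans map_zero.symm), fun h => h ▸ map_zero⟩
  · rw [← hF.map_norm _ (add_mem a ha b hb), ← hF.map_norm a ha, ← hF.map_norm b hb,
      hF.map_add a ha b hb]
    exact hS'.norm_add_le _ (hm a ha) _ (hm b hb)
  · rw [← hF.map_norm _ (smul_mem c a ha), ← hF.map_norm a ha, hF.map_smul c a ha]
    exact hS'.norm_smul c _ (hm a ha)
  · have e : ∀ a ∈ S, ∀ b ∈ S, nrm (a - b) = nrm' (F a - F b) := fun a ha b hb => by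
      rw [← map_sub a ha b hb, hF.map_norm _ (sub_mem a ha b hb)]
    obtain ⟨b, hb, hlim⟩ := hS'.complete (fun n => F (u n)) (fun n => hm _ (hu n)) fun ε hε => by
      obtain ⟨N, hN⟩ := hc ε hε
      exact ⟨N, fun m hm' n hn => e _ (hu m) _ (hu n) ▸ hN m hm' n hn⟩
    obtain ⟨a, ha, rfl⟩ := closed u b hu hb hlim
    exact ⟨a, ha, by simpa only [e _ (hu _) a ha] using hlim⟩
  · rw [hF.map_mul _ (add_mem a ha b hb) c hc, hF.map_add a ha b hb,
      hS'.add_mul _ (hm a ha) _ (hm b hb) _ (hm c hc),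
      hF.map_add _ (mul_mem a ha c hc) _ (mul_mem b hb c hc), hF.map_mul a ha c hc,
      hF.map_mul b hb c hc]
  · rw [hF.map_mul a ha _ (add_mem b hb c hc), hF.map_add b hb c hc,
      hS'.mul_add _ (hm a ha) _ (hm b hb) _ (hm c hc),
      hF.map_add _ (mul_mem a ha b hb) _ (mul_mem a ha c hc), hF.map_mul a ha b hb,
      hF.map_mul a ha c hc]
  · rw [hF.map_mul _ (smul_mem c a ha) b hb, hF.map_smul c a ha,
      hS'.smul_mul c _ (hm a ha) _ (hm b hb), hF.map_smul c _ (mul_mem a ha b hb),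
      hF.map_mul a ha b hb]
  · rw [hF.map_mul a ha _ (smul_mem c b hb), hF.map_smul c b hb,
      hS'.mul_smul c _ (hm a ha) _ (hm b hb), hF.map_smul c _ (mul_mem a ha b hb),
      hF.map_mul a ha b hb]
  · rw [hF.map_mul _ (mul_mem a ha b hb) c hc, hF.map_mul a ha b hb,
      hF.map_mul a ha _ (mul_mem b hb c hc), hF.map_mul b hb c hc]
    exact hS'.mul_assoc _ (hm a ha) _ (hm b hb) _ (hm c hc)
  · rw [← hF.map_norm _ (mul_mem a ha b hb), ← hF.map_norm a ha, ← hF.map_norm b hb,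
      hF.map_mul a ha b hb]
    exact hS'.norm_mul_le _ (hm a ha) _ (hm b hb)
  · rw [hF.map_inv _ (add_mem a ha b hb), hF.map_add a ha b hb,
      hF.map_add _ (inv_mem a ha) _ (inv_mem b hb), hF.map_inv a ha, hF.map_inv b hb]
    exact hS'.inv_add _ (hm a ha) _ (hm b hb)
  · rw [hF.map_inv _ (smul_mem c a ha), hF.map_smul c a ha, hF.map_smul _ _ (inv_mem a ha),
      hF.map_inv a ha]
    exact hS'.inv_smul c _ (hm a ha)
  · rw [hF.map_inv _ (inv_mem a ha), hF.map_inv a ha]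
    exact hS'.inv_inv _ (hm a ha)
  · rw [hF.map_inv _ (mul_mem a ha b hb), hF.map_mul a ha b hb,
      hF.map_mul _ (inv_mem b hb) _ (inv_mem a ha), hF.map_inv a ha, hF.map_inv b hb]
    exact hS'.inv_mul _ (hm a ha) _ (hm b hb)
  · rw [← hF.map_norm _ (inv_mem a ha), ← hF.map_norm a ha, hF.map_inv a ha]
    exact hS'.norm_inv _ (hm a ha)

end Transfer

/-! ### The algebra of invariant measures -/

section MeasureAlgebra

variable {G : Type*} [Group G] [TopologicalSpace G] [IsTopologicalGroup G] [LocallyCompactSpace G]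
  [T2Space G] [MeasurableSpace G] [BorelSpace G]

theorem isBanachStarAlgebra_dual : IsBanachStarAlgebra (Set.univ : Set (C₀(G, ℂ) →L[ℂ] ℂ))
    (fun Λ => ‖Λ‖) convDual starDual where
  zero_mem := trivial
  add_mem _ _ _ _ := trivial
  smul_mem _ _ _ := trivial
  mul_mem _ _ _ _ := trivial
  inv_mem _ _ := trivial
  norm_nonneg Λ _ := norm_nonneg Λ
  norm_eq_zero Λ _ := norm_eq_zero (a := Λ)
  norm_add_le Λ _ Λ' _ := norm_add_le Λ Λ'
  norm_smul c Λ _ := norm_smul c Λ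
  complete u _ hc := by
    have : CauchySeq u := Metric.cauchySeq_iff.2 fun ε hε => by
      obtain ⟨N, hN⟩ := hc ε hε
      exact ⟨N, fun m hm n hn => by rw [dist_eq_norm]; exact hN m hm n hn⟩
    obtain ⟨Λ, hΛ⟩ := cauchySeq_tendsto_of_complete this
    exact ⟨Λ, trivial, tendsto_iff_norm_sub_tendsto_zero.1 hΛ⟩
  add_mul Λ₁ _ Λ₂ _ Λ₃ _ := convDual_add_left Λ₁ Λ₂ Λ₃
  mul_add _ _ _ _ _ _ := rfl
  smul_mul c Λ _ Λ' _ := convDual_smul_left c Λ Λ'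
  mul_smul _ _ _ _ _ := rfl
  mul_assoc Λ₁ _ Λ₂ _ Λ₃ _ := convDual_assoc Λ₁ Λ₂ Λ₃
  norm_mul_le Λ _ Λ' _ := norm_convDual_le Λ Λ'
  inv_add Λ _ Λ' _ := starDual_add Λ Λ'
  inv_smul c Λ _ := starDual_smul c Λ
  inv_inv Λ _ := starDual_starDual Λ
  inv_mul Λ _ Λ' _ := starDual_convDual Λ Λ'
  norm_inv Λ _ := norm_starDual Λ

variable {H : Subgroup G} [CompactSpace H]

theorem measConv_mem {κ κ' : ComplexMeasure (CosetSpace H)} (h : κ ∈ invariantMeasures H) :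
    measConv H κ κ' ∈ invariantMeasures H := by
  rw [mem_invariantMeasures_iff] at h ⊢
  refine ⟨(dual_measConv κ κ').1, ?_⟩
  rw [(dual_measConv κ κ').2]
  exact isInvariant_cosetConv h.2

theorem measInv_mem {κ : ComplexMeasure (CosetSpace H)} (h : κ ∈ invariantMeasures H) :
    measInv H κ ∈ invariantMeasures H := by
  rw [mem_invariantMeasures_iff] at h ⊢
  refine ⟨(dual_measInv κ).1, ?_⟩
  rw [(dual_measInv κ).2]
  exact isInvariant_cosetStar h.2

theorem isInvariant_add {Λ Λ' : C₀(CosetSpace H, ℂ) →L[ℂ] ℂ} (h : IsInvariant H Λ)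
    (h' : IsInvariant H Λ') : IsInvariant H (Λ + Λ') := by
  rw [isInvariant_iff] at *
  intro k hk ψ
  rw [add_apply, add_apply, h k hk, h' k hk]

theorem isInvariant_smul (c : ℂ) {Λ : C₀(CosetSpace H, ℂ) →L[ℂ] ℂ} (h : IsInvariant H Λ) :
    IsInvariant H (c • Λ) := by
  rw [isInvariant_iff] at *
  intro k hk ψ
  rw [smul_apply, smul_apply, h k hk]

variable (H) in
theorem zero_mem_invariantMeasures : (0 : ComplexMeasure (CosetSpace H)) ∈ invariantMeasures H := by
  refine ⟨?_, fun _ _ _ _ => rfl⟩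
  change (VectorMeasure.variation _).Regular
  rw [VectorMeasure.variation_zero]
  infer_instance

theorem isIsometricStarEmbedding_lift : IsIsometricStarEmbedding (invariantMeasures H) tvNorm
    (measConv H) (measInv H) (Set.univ : Set (C₀(G, ℂ) →L[ℂ] ℂ)) (fun Λ => ‖Λ‖) convDual starDual
    fun κ => lift H (dual κ) where
  mapsTo _ _ := trivial
  injOn κ hκ κ' hκ' h := dual_injOn hκ.1 hκ'.1 (lift_injective H h)
  map_add κ _ κ' _ := by rw [dual_add, lift_add]
  map_smul c κ _ := by rw [dual_smul, lift_smul]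
  map_mul κ _ κ' _ := by rw [(dual_measConv κ κ').2, lift_cosetConv]
  map_inv κ hκ := by
    rw [(dual_measInv κ).2, lift_cosetStar (mem_invariantMeasures_iff.1 hκ).2]
  map_norm κ hκ := by rw [norm_lift, norm_dual hκ.1]

theorem isBanachStarAlgebra_invariantMeasures :
    IsBanachStarAlgebra (invariantMeasures H) tvNorm (measConv H) (measInv H) := by
  refine isIsometricStarEmbedding_lift.isBanachStarAlgebra isBanachStarAlgebra_dual
    (zero_mem_invariantMeasures H) (fun κ hκ κ' hκ' => ?_) (fun c κ hκ => ?_)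
    (fun κ hκ κ' _ => measConv_mem hκ) (fun κ hκ => measInv_mem hκ) fun u Λ hu _ hlim => ?_
  · rw [mem_invariantMeasures_iff] at *
    rw [dual_add]
    exact ⟨regular_add hκ.1 hκ'.1, isInvariant_add hκ.2 hκ'.2⟩
  · rw [mem_invariantMeasures_iff] at *
    rw [dual_smul]
    exact ⟨regular_smul c hκ.1, isInvariant_smul c hκ.2⟩
  · have h1 : Tendsto (fun n => lift H (dual (u n))) atTop (𝓝 Λ) :=
      tendsto_iff_norm_sub_tendsto_zero.2 hlim
    -- The two fixed-point equations are closed conditions. The right one lets the limit descend to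
    -- `G/H`, the left one makes it invariant.
    have h2 : convDual Λ (haarDual H) = Λ :=
      tendsto_nhds_unique (((convDualCLM.flip (haarDual H)).continuous.tendsto Λ).comp h1)
        (h1.congr fun n => (convDual_lift_haarDual H (dual (u n))).symm)
    have h3 : convDual (haarDual H) Λ = Λ :=
      tendsto_nhds_unique (((convDualCLM (haarDual H)).continuous.tendsto Λ).comp h1)
        (h1.congr fun n => ((mem_invariantMeasures_iff.1 (hu n)).2 : _ = _).symm)
    have h4 := lift_comp_pull_of_convDual H h2
    obtain ⟨κ, hκ, h5⟩ := exists_dual_eq (Λ.comp (pull H))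
    refine ⟨κ, mem_invariantMeasures_iff.2 ⟨hκ, ?_⟩, by rw [h5, h4]⟩
    rw [h5, IsInvariant, h4, h3]

end MeasureAlgebra

/-! ### The modular function and inversion of Haar integrals -/

section HaarIntegral

variable {G : Type*} [Group G] [TopologicalSpace G] [IsTopologicalGroup G] [LocallyCompactSpace G]
  [MeasurableSpace G] [BorelSpace G] (σ : Measure G) [σ.IsHaarMeasure] [σ.Regular]

theorem map_mul_right_eq_smul (g : G) :
    σ.map (· * g) = Measure.modularCharacterFun g • σ := by
  have : (σ.map (· * g)).Regular := Measure.Regular.map (Homeomorph.mulRight g)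
  rw [Measure.modularCharacterFun_eq_haarScalarFactor σ g]
  exact Measure.isMulLeftInvariant_eq_smul_of_regular _ σ

theorem integral_mul_right_eq_modular {f : G → ℝ} (hf : Continuous f) (g : G) :
    ∫ x, f (x * g) ∂σ = Measure.modularCharacterFun g * ∫ x, f x ∂σ := by
  rw [← integral_map (φ := (· * g)) (measurable_mul_const g).aemeasurable
    hf.aestronglyMeasurable, map_mul_right_eq_smul, integral_smul_nnreal_measure, NNReal.smul_def,
    smul_eq_mul]

include σ in
-- Up to a nonzero constant it is `g ↦ ∫ f (x g) dσ` for a bump function `f`. The substitution of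
-- `x⁻¹` for `x` makes this an integral against `σ.inv` that depends continuously on `g`.
theorem continuous_modularCharacterFun :
    Continuous fun g : G => (Measure.modularCharacterFun g : ℝ) := by
  obtain ⟨⟨f, hf⟩, hfc, hf0, hf1⟩ :
    ∃ f : C(G, ℝ), HasCompactSupport f ∧ 0 ≤ f ∧ f 1 ≠ 0 := exists_continuous_nonneg_pos 1
  have hI : ∫ x, f x ∂σ ≠ 0 :=
    (hf.integral_pos_of_hasCompactSupport_nonneg_nonzero hfc hf0 hf1).ne'
  have h1 : Continuous fun g : G => ∫ x, f (x * g) ∂σ := by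
    have h2 := continuous_integral_apply_inv_mul (μ := σ.inv) hf hfc
    refine h2.congr fun g => ?_
    rw [Measure.inv, integral_map measurable_inv.aemeasurable
      (by fun_prop : Continuous fun y => f (y⁻¹ * g)).aestronglyMeasurable]
    simp
  refine (h1.div_const (∫ x, f x ∂σ)).congr fun g => ?_
  rw [integral_mul_right_eq_modular σ hf, mul_div_cancel_right₀ _ hI]

/-- Compare the left invariant `σ` with the right invariant `σ.inv` through an auxiliary bump
function `g`. Its translated integrals are the modular factor times `∫ g`, so `g` cancels and only
that factor remains. -/
theorem integral_inv_eq_modular_real {f : G → ℝ} (hf : Continuous f) (hfc : HasCompactSupport f) :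
    ∫ x, f x⁻¹ * Measure.modularCharacterFun x ∂σ = ∫ x, f x ∂σ := by
  obtain ⟨⟨g, hg⟩, hgc, hg0, hg1⟩ :
    ∃ f : C(G, ℝ), HasCompactSupport f ∧ 0 ≤ f ∧ f 1 ≠ 0 := exists_continuous_nonneg_pos 1
  have hI : ∫ x, g x ∂σ ≠ 0 :=
    (hg.integral_pos_of_hasCompactSupport_nonneg_nonzero hgc hg0 hg1).ne'
  have hm := continuous_modularCharacterFun σ
  have hm0 : ∀ y : G, (Measure.modularCharacterFun y : ℝ) ≠ 0 := fun y =>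
    (NNReal.coe_pos.2 (Measure.modularCharacterFun_pos y)).ne'
  have hinv : ∀ y : G, (Measure.modularCharacterFun y⁻¹ : ℝ) =
      (Measure.modularCharacterFun y : ℝ)⁻¹ :=
    fun y => by
      refine eq_inv_of_mul_eq_one_left ?_
      rw [← NNReal.coe_mul, ← Measure.modularCharacterFun_map_mul,
        inv_mul_cancel, Measure.modularCharacterFun_map_one, NNReal.coe_one]
  have h1 := Measure.integral_isMulLeftInvariant_isMulRightInvariant_combo (μ := σ) (ν := σ.inv)
    hf hfc hg hgc hg0 hg1
  have h2 : ∀ y : G, ∫ z, g (z⁻¹ * y) ∂σ.inv = Measure.modularCharacterFun y * ∫ x, g x ∂σ := by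
    intro y
    rw [← integral_mul_right_eq_modular σ hg, Measure.inv, integral_map measurable_inv.aemeasurable
      (by fun_prop : Continuous fun z => g (z⁻¹ * y)).aestronglyMeasurable]
    simp
  simp only [h2, mul_inv, ← mul_assoc] at h1
  rw [integral_mul_const, inv_mul_cancel_right₀ hI] at h1
  have hc : Continuous fun y => f y * (Measure.modularCharacterFun y : ℝ)⁻¹ :=
    hf.mul (hm.inv₀ hm0)
  rw [h1, Measure.inv, integral_map measurable_inv.aemeasurable hc.aestronglyMeasurable]
  simp only [hinv, inv_inv]

theorem integral_inv_eq_modular {f : G → ℂ} (hf : Continuous f) (hfc : HasCompactSupport f) :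
    ∫ x, f x⁻¹ * (Measure.modularCharacterFun x : ℝ) ∂σ = ∫ x, f x ∂σ := by
  have hm := continuous_modularCharacterFun σ
  have hi : Integrable f σ := hf.integrable_of_hasCompactSupport hfc
  have hi' : Integrable (fun x => f x⁻¹ * (Measure.modularCharacterFun x : ℝ)) σ := by
    refine Continuous.integrable_of_hasCompactSupport (by fun_prop) ?_
    exact HasCompactSupport.mul_right (hfc.comp_homeomorph (Homeomorph.inv G))
  refine Complex.ext ?_ ?_
  · have h1 := integral_inv_eq_modular_real σ (Complex.continuous_re.comp hf)
      (hfc.comp_left Complex.zero_re)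
    have h2 := integral_re hi
    have h3 := integral_re hi'
    simp only [RCLike.re_eq_complex_re, Complex.re_mul_ofReal] at h2 h3
    rw [← h2, ← h3]
    exact h1
  · have h1 := integral_inv_eq_modular_real σ (Complex.continuous_im.comp hf)
      (hfc.comp_left Complex.zero_im)
    have h2 := integral_im hi
    have h3 := integral_im hi'
    simp only [RCLike.im_eq_complex_im, Complex.im_mul_ofReal] at h2 h3
    rw [← h2, ← h3]
    exact h1

include σ in
-- On the compact group `H` the character attains a maximum at some `k₀`; comparing with `k₀ k`
-- gives the bound `1` at every `k`, and inverses give equality.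
theorem modularCharacterFun_eq_one {H : Subgroup G} [CompactSpace H] (h : H) :
    Measure.modularCharacterFun (h : G) = 1 := by
  have hm : Continuous fun k : H => (Measure.modularCharacterFun (k : G) : ℝ) :=
    (continuous_modularCharacterFun σ).comp continuous_subtype_val
  obtain ⟨k₀, -, hk₀⟩ := isCompact_univ.exists_isMaxOn Set.univ_nonempty hm.continuousOn
  have h1 : ∀ k : H, Measure.modularCharacterFun (k : G) ≤ 1 := fun k => by
    have h2 := isMaxOn_iff.1 hk₀ (k₀ * k) (Set.mem_univ _)
    rw [Subgroup.coe_mul, Measure.modularCharacterFun_map_mul, NNReal.coe_le_coe] at h2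
    exact (mul_le_iff_le_one_right (Measure.modularCharacterFun_pos _)).1 h2
  refine le_antisymm (h1 h) ?_
  have h2 := h1 h⁻¹
  have h3 : Measure.modularCharacterFun (h : G) *
      Measure.modularCharacterFun ((h⁻¹ : H) : G) = 1 := by
    rw [← Measure.modularCharacterFun_map_mul, Subgroup.coe_inv, mul_inv_cancel,
      Measure.modularCharacterFun_map_one]
  rw [← h3]
  exact mul_le_of_le_one_right zero_le h2

include σ in
theorem modularCharacterFun_mul_coe {H : Subgroup G} [CompactSpace H] (x : G) (h : H) :
    Measure.modularCharacterFun (x * h) = Measure.modularCharacterFun x := by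
  rw [Measure.modularCharacterFun_map_mul, modularCharacterFun_eq_one σ, mul_one]

end HaarIntegral

/-! ### Compactly supported functions on `G/H` seen on `G` -/

section CosetFunctions

variable {G : Type*} [Group G] [TopologicalSpace G] [IsTopologicalGroup G] {H : Subgroup G}

theorem hasCompactSupport_comp_mk [CompactSpace H] (F : C_c(CosetSpace H, ℂ)) :
    HasCompactSupport fun x : G => F (CosetSpace.mk H x) :=
  HasCompactSupport.intro' ((isProperMap_mk H).isCompact_preimage F.hasCompactSupport)
    ((isClosed_tsupport F).preimage (continuous_mk H))
    fun _ hx => image_eq_zero_of_notMem_tsupport hx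

theorem continuous_comp_mk (F : C_c(CosetSpace H, ℂ)) :
    Continuous fun x : G => F (CosetSpace.mk H x) := F.continuous.comp (continuous_mk H)

/-- A function on `G/H` as an element of `C_c(G/H)`, from properties of its composition with the
canonical map. -/
def ofCompMk [T2Space G] [CompactSpace H] (f : CosetSpace H → ℂ)
    (hf : Continuous fun x => f (CosetSpace.mk H x)) {K : Set (CosetSpace H)} (hK : IsCompact K)
    (h : ∀ x ∉ K, f x = 0) : C_c(CosetSpace H, ℂ) :=
  ⟨⟨f, (isOpenQuotientMap_mk H).continuous_comp_iff.1 hf⟩, HasCompactSupport.intro hK h⟩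

end CosetFunctions

/-! ### Weil's formula: operations on `C_c(G/H)` as operations on functionals -/

section Weil

variable {G : Type*} [Group G] [TopologicalSpace G] [IsTopologicalGroup G] [LocallyCompactSpace G]
  [T2Space G] [MeasurableSpace G] [BorelSpace G] {H : Subgroup G} [CompactSpace H]
  {σ : Measure G} [σ.IsHaarMeasure] [σ.Regular] {μ : Measure (CosetSpace H)}

omit [T2Space G] [σ.IsHaarMeasure] [σ.Regular] in
theorem WeilFormula.integral_eq (hμ : WeilFormula H σ μ) {f : G → ℂ} (hf : Continuous f)
    (hfc : HasCompactSupport f) {F : CosetSpace H → ℂ} (h : ∀ x, cosetAverage H f x = F x) :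
    ∫ x, F x ∂μ = ∫ x, f x ∂σ := by
  exact (integral_congr_ae (ae_of_all _ fun x => (h x).symm)).trans (hμ ⟨⟨f, hf⟩, hfc⟩)

omit [σ.IsHaarMeasure] [σ.Regular] in
-- Weil's formula in dual form: lifting `F dμ` gives `(F ∘ q) dσ`, with `q` the quotient map.
theorem lift_densityDual (hμ : WeilFormula H σ μ) {φ : Lp ℂ 1 μ} {F : C_c(CosetSpace H, ℂ)}
    (hφ : φ =ᵐ[μ] F) (f : C₀(G, ℂ)) :
    lift H (densityDual μ φ) f = ∫ x, f x * F (CosetSpace.mk H x) ∂σ := by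
  rw [lift_apply, densityDual_apply_of_ae μ hφ]
  refine hμ.integral_eq (f := fun x => f x * F (CosetSpace.mk H x))
    (f.continuous.mul (continuous_comp_mk F)) (hasCompactSupport_comp_mk F).mul_left fun x => ?_
  rw [push_apply, cosetAverage, ← integral_mul_const]
  simp only [mk_mul, CosetSpace.mk_rep]

omit [σ.IsHaarMeasure] [σ.Regular] in
-- On `G` this is the usual group convolution. Replacing `x` by `x h` changes `x⁻¹ g` to `h⁻¹ x⁻¹
-- g`, which is what the average `leftAverage` accounts for, up to inversion in `H`.
theorem convFun_mk (hμ : WeilFormula H σ μ) (F₁ F₂ : C_c(CosetSpace H, ℂ)) (g : G) :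
    convFun H μ F₁ F₂ (CosetSpace.mk H g) =
      ∫ x, F₁ (CosetSpace.mk H x) * F₂ (CosetSpace.mk H (x⁻¹ * g)) ∂σ := by
  have h2 := continuous_comp_mk F₂
  refine hμ.integral_eq (f := fun x => F₁ (CosetSpace.mk H x) * F₂ (CosetSpace.mk H (x⁻¹ * g)))
    ((continuous_comp_mk F₁).mul (h2.comp (by fun_prop : Continuous fun x => x⁻¹ * g)))
    (hasCompactSupport_comp_mk F₁).mul_right fun z => ?_
  have h3 : Continuous fun h : H => F₂ (CosetSpace.mk H ((h : G) * (z.rep⁻¹ * g))) :=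
    h2.comp (by fun_prop : Continuous fun h : H => (h : G) * (z.rep⁻¹ * g))
  rw [leftAverage, cosetAverage, smul_mk]
  simp only [smul_mk, mk_mul, CosetSpace.mk_rep, mul_inv_rev, mul_assoc]
  rw [integral_const_mul, ← integral_haarProb_inv h3]
  simp only [Subgroup.coe_inv]

/-- The convolution of two functions in `C_c(G/H)` belongs to `C_c(G/H)`. -/
theorem exists_eq_convFun (hμ : WeilFormula H σ μ) (F₁ F₂ : C_c(CosetSpace H, ℂ)) :
    ∃ F : C_c(CosetSpace H, ℂ), ⇑F = convFun H μ F₁ F₂ := by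
  have h1 := hasCompactSupport_comp_mk F₁
  have h2 := hasCompactSupport_comp_mk F₂
  set K₁ := tsupport fun x : G => F₁ (CosetSpace.mk H x) with hK₁
  set K₂ := tsupport fun x : G => F₂ (CosetSpace.mk H x) with hK₂
  -- The convolution vanishes off the image of `K₁ K₂`.
  refine ⟨ofCompMk (convFun H μ F₁ F₂) ?_ (K := (fun z : G × G => CosetSpace.mk H (z.1 * z.2)) ''
    (K₁ ×ˢ K₂)) ((h1.isCompact.prod h2.isCompact).image ((continuous_mk H).comp (by fun_prop)))
    fun y hy => ?_, rfl⟩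
  · simp only [convFun_mk hμ]
    rw [← continuousOn_univ]
    refine continuousOn_integral_of_compact_support h1.isCompact ?_ fun p x _ hx => ?_
    · refine Continuous.continuousOn ?_
      have c1 := continuous_comp_mk F₁
      have c2 := continuous_comp_mk F₂
      exact (c1.comp continuous_snd).mul
        (c2.comp (by fun_prop : Continuous fun z : G × G => z.2⁻¹ * z.1))
    · rw [image_eq_zero_of_notMem_tsupport (f := fun x : G => F₁ (CosetSpace.mk H x)) hx, zero_mul]
  · obtain ⟨g, rfl⟩ := mk_surjective H y
    rw [convFun_mk hμ]
    refine integral_eq_zero_of_ae (ae_of_all _ fun x => ?_)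
    by_contra h
    obtain ⟨ha, hb⟩ := mul_ne_zero_iff.1 h
    exact hy ⟨(x, x⁻¹ * g), ⟨subset_tsupport (fun x : G => F₁ (CosetSpace.mk H x)) ha,
      subset_tsupport (fun x : G => F₂ (CosetSpace.mk H x)) hb⟩, by simp⟩

/-- After lifting to `G` the two sides differ by Fubini and the left translation `y ↦ x y`. -/
theorem cosetConv_densityDual (hμ : WeilFormula H σ μ) {φ₁ φ₂ φ : Lp ℂ 1 μ}
    {F₁ F₂ : C_c(CosetSpace H, ℂ)} (h₁ : φ₁ =ᵐ[μ] F₁) (h₂ : φ₂ =ᵐ[μ] F₂)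
    (h : φ =ᵐ[μ] convFun H μ F₁ F₂) :
    cosetConv H (densityDual μ φ₁) (densityDual μ φ₂) = densityDual μ φ := by
  obtain ⟨F, hF⟩ := exists_eq_convFun hμ F₁ F₂
  rw [← hF] at h
  refine lift_injective H (ContinuousLinearMap.ext fun f => ?_)
  rw [lift_cosetConv, convDual_apply, lift_densityDual hμ h₂, lift_densityDual hμ h]
  have c1 := continuous_comp_mk F₁
  have c2 := continuous_comp_mk F₂
  have s1 := hasCompactSupport_comp_mk F₁
  have s2 := hasCompactSupport_comp_mk F₂
  have e1 : ∀ y, slice (lift H (densityDual μ φ₁)) f y =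
      ∫ x, f (x * y) * F₁ (CosetSpace.mk H x) ∂σ := fun y => by
    rw [slice_apply, lift_densityDual hμ h₁]
    rfl
  have e2 : ∀ y, ∫ x, f y * (F₁ (CosetSpace.mk H x) * F₂ (CosetSpace.mk H (x⁻¹ * y))) ∂σ =
      f y * F (CosetSpace.mk H y) := fun y => by
    rw [integral_const_mul, hF, convFun_mk hμ]
  simp only [e1, ← e2, ← integral_mul_const]
  rw [integral_integral_swap_of_hasCompactSupport]
  · rw [integral_integral_swap_of_hasCompactSupport (f := fun y x =>
      f y * (F₁ (CosetSpace.mk H x) * F₂ (CosetSpace.mk H (x⁻¹ * y))))]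
    · refine integral_congr_ae (ae_of_all _ fun x => ?_)
      change _ = ∫ y, f y * (F₁ (CosetSpace.mk H x) * F₂ (CosetSpace.mk H (x⁻¹ * y))) ∂σ
      rw [← integral_mul_left_eq_self _ x]
      simp only [inv_mul_cancel_left, mul_assoc]
    · exact (f.continuous.comp continuous_fst).mul ((c1.comp continuous_snd).mul
        (c2.comp (by fun_prop : Continuous fun z : G × G => z.2⁻¹ * z.1)))
    -- A pair `(y, x)` in the support has `x` in the first support and `x⁻¹ y` in the second, so it
    -- equals `(x (x⁻¹ y), x)`.
    · refine HasCompactSupport.intro (K := (fun z : G × G => (z.1 * z.2, z.1)) '' (_ ×ˢ _))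
        ((s1.isCompact.prod s2.isCompact).image (by fun_prop)) fun z hz => ?_
      by_contra h0
      simp only [Function.uncurry_def, mul_ne_zero_iff] at h0
      exact hz ⟨(z.2, z.2⁻¹ * z.1), ⟨subset_tsupport (fun x : G => F₁ (CosetSpace.mk H x)) h0.2.1,
        subset_tsupport (fun x : G => F₂ (CosetSpace.mk H x)) h0.2.2⟩, by simp⟩
  · exact ((f.continuous.comp (continuous_snd.mul continuous_fst)).mul
      (c1.comp continuous_snd)).mul (c2.comp continuous_fst)
  · refine HasCompactSupport.intro (s2.isCompact.prod s1.isCompact) fun z hz => ?_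
    by_contra h0
    simp only [Function.uncurry_def, mul_ne_zero_iff] at h0
    exact hz ⟨subset_tsupport (fun x : G => F₂ (CosetSpace.mk H x)) h0.2,
      subset_tsupport (fun x : G => F₁ (CosetSpace.mk H x)) h0.1.2⟩

omit [T2Space G] in
include σ in
-- The modular function is trivial on `H`, so the representative does not matter; the two inverses
-- in the conventions cancel.
theorem modularFunction_rep_mk (g : G) :
    modularFunction (CosetSpace.mk H g).rep⁻¹ = Measure.modularCharacterFun g := by
  obtain ⟨h, hh⟩ := exists_rep_mk H g
  rw [modularFunction, inv_inv, hh, modularCharacterFun_mul_coe σ]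

/-- The involution of a function in `C_c(G/H)` belongs to `C_c(G/H)`. -/
theorem exists_eq_invFun (σ : Measure G) [σ.IsHaarMeasure] [σ.Regular] (F : C_c(CosetSpace H, ℂ)) :
    ∃ F' : C_c(CosetSpace H, ℂ), ⇑F' = invFun H F := by
  have c1 := continuous_comp_mk F
  have s1 := hasCompactSupport_comp_mk F
  set K := tsupport fun x : G => F (CosetSpace.mk H x) with hK
  let f : C₀(G, ℂ) := flip (ofCompactSupport _ c1 s1)
  have h1 : ∀ x, invFun H F x = (modularFunction x.rep⁻¹ : ℂ) * push H f x := fun x => by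
    rw [invFun, push_apply]
    simp only [f, flip_apply, ofCompactSupport_apply, mul_inv_rev]
  refine ⟨ofCompMk (invFun H F) ?_ (K := (fun z : G => CosetSpace.mk H z⁻¹) '' K)
    (s1.isCompact.image ((continuous_mk H).comp continuous_inv)) fun y hy => ?_, rfl⟩
  · simp only [h1, modularFunction_rep_mk (σ := σ)]
    exact (Complex.continuous_ofReal.comp (continuous_modularCharacterFun σ)).mul
      ((push H f).continuous.comp (continuous_mk H))
  · rw [invFun]
    refine mul_eq_zero_of_right _ (integral_eq_zero_of_ae (ae_of_all _ fun h => ?_))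
    by_contra h0
    have h2 : F (CosetSpace.mk H ((h : G)⁻¹ * y.rep⁻¹)) ≠ 0 := fun h3 => h0 (by simp [h3])
    refine hy ⟨_, subset_tsupport (fun x : G => F (CosetSpace.mk H x)) h2, ?_⟩
    simp [mk_mul, CosetSpace.mk_rep]

/-- After lifting, the change of variables `x ↦ x⁻¹` in `σ` produces the modular factor of the
involution, and Weil's formula returns to `G/H`. -/
theorem cosetStar_densityDual (hμ : WeilFormula H σ μ) {φ φ' : Lp ℂ 1 μ}
    {F : C_c(CosetSpace H, ℂ)} (h : φ =ᵐ[μ] F) (h' : φ' =ᵐ[μ] invFun H F) :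
    cosetStar H (densityDual μ φ) = densityDual μ φ' := by
  ext ψ
  have c1 := continuous_comp_mk F
  have s1 := hasCompactSupport_comp_mk F
  have cm := continuous_modularCharacterFun σ
  have cp : Continuous fun x : G => ψ (CosetSpace.mk H x) := ψ.continuous.comp (continuous_mk H)
  rw [densityDual_apply_of_ae μ h']
  change starRingEnd ℂ (lift H (densityDual μ φ) (flip (pull H ψ))) = _
  rw [lift_densityDual hμ h, ← integral_conj]
  simp only [flip_apply, pull_apply, map_mul, Complex.conj_conj]
  rw [← integral_inv_eq_modular σ
    (f := fun x => ψ (CosetSpace.mk H x⁻¹) * starRingEnd ℂ (F (CosetSpace.mk H x)))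
    ((cp.comp continuous_inv).mul (Complex.continuous_conj.comp c1))
    (HasCompactSupport.mul_left (s1.comp_left (map_zero (starRingEnd ℂ))))]
  refine (hμ.integral_eq (f := fun x => ψ (CosetSpace.mk H x⁻¹⁻¹) * starRingEnd ℂ
    (F (CosetSpace.mk H x⁻¹)) * (Measure.modularCharacterFun x : ℝ)) ?_ ?_ fun x => ?_).symm
  · exact ((cp.comp (continuous_inv.comp continuous_inv)).mul
      (Complex.continuous_conj.comp (c1.comp continuous_inv))).mul
      (Complex.continuous_ofReal.comp cm)
  · exact (HasCompactSupport.mul_left ((s1.comp_homeomorph (Homeomorph.inv G)).comp_left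
      (map_zero (starRingEnd ℂ)))).mul_right
  · rw [cosetAverage, invFun]
    simp only [inv_inv, mul_inv_rev, mk_mul, CosetSpace.mk_rep, modularCharacterFun_mul_coe σ]
    rw [integral_mul_const, integral_const_mul, modularFunction, inv_inv]
    ring

end Weil

/-! ### Bounded operations on the dual of `C₀(G/H)` -/

section DualOperations

variable {G : Type*} [Group G] [TopologicalSpace G] [IsTopologicalGroup G] [LocallyCompactSpace G]
  [T2Space G] [MeasurableSpace G] [BorelSpace G] (H : Subgroup G) [CompactSpace H]

theorem cosetConv_add_left (Λ₁ Λ₂ Λ : C₀(CosetSpace H, ℂ) →L[ℂ] ℂ) :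
    cosetConv H (Λ₁ + Λ₂) Λ = cosetConv H Λ₁ Λ + cosetConv H Λ₂ Λ := by
  rw [cosetConv, lift_add, convDual_add_left]
  rfl

theorem cosetConv_smul_left (c : ℂ) (Λ Λ' : C₀(CosetSpace H, ℂ) →L[ℂ] ℂ) :
    cosetConv H (c • Λ) Λ' = c • cosetConv H Λ Λ' := by
  rw [cosetConv, lift_smul, convDual_smul_left]
  rfl

theorem norm_cosetConv_le (Λ Λ' : C₀(CosetSpace H, ℂ) →L[ℂ] ℂ) :
    ‖cosetConv H Λ Λ'‖ ≤ ‖Λ‖ * ‖Λ'‖ := by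
  rw [← norm_lift H, lift_cosetConv, ← norm_lift H Λ, ← norm_lift H Λ']
  exact norm_convDual_le _ _

/-- The convolution on the dual of `C₀(G/H)` as a bounded bilinear map. -/
def cosetConvCLM : (C₀(CosetSpace H, ℂ) →L[ℂ] ℂ) →L[ℂ] (C₀(CosetSpace H, ℂ) →L[ℂ] ℂ) →L[ℂ]
    (C₀(CosetSpace H, ℂ) →L[ℂ] ℂ) :=
  LinearMap.mkContinuous₂
    (LinearMap.mk₂ ℂ (cosetConv H) (cosetConv_add_left H) (cosetConv_smul_left H)
      (fun _ _ _ => rfl) (fun _ _ _ => rfl)) 1 fun Λ Λ' => by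
      rw [one_mul]
      exact norm_cosetConv_le H Λ Λ'

theorem cosetStar_add (Λ Λ' : C₀(CosetSpace H, ℂ) →L[ℂ] ℂ) :
    cosetStar H (Λ + Λ') = cosetStar H Λ + cosetStar H Λ' := by
  rw [cosetStar, lift_add, starDual_add]
  rfl

theorem cosetStar_smul (c : ℂ) (Λ : C₀(CosetSpace H, ℂ) →L[ℂ] ℂ) :
    cosetStar H (c • Λ) = starRingEnd ℂ c • cosetStar H Λ := by
  rw [cosetStar, lift_smul, starDual_smul]
  rfl

theorem norm_cosetStar_le (Λ : C₀(CosetSpace H, ℂ) →L[ℂ] ℂ) : ‖cosetStar H Λ‖ ≤ ‖Λ‖ := by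
  rw [← norm_lift H Λ, ← norm_starDual (lift H Λ)]
  exact ContinuousLinearMap.opNorm_le_bound _ (norm_nonneg (starDual (lift H Λ))) fun ψ =>
    (starDual (lift H Λ)).le_opNorm_of_le (norm_pull_le ψ)

/-- The involution on the dual of `C₀(G/H)` as a bounded conjugate-linear map. -/
def cosetStarCLM : (C₀(CosetSpace H, ℂ) →L[ℂ] ℂ) →L⋆[ℂ] (C₀(CosetSpace H, ℂ) →L[ℂ] ℂ) :=
  LinearMap.mkContinuous
    { toFun := cosetStar H
      map_add' := cosetStar_add H
      map_smul' := cosetStar_smul H } 1 fun Λ => by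
      rw [one_mul]
      exact norm_cosetStar_le H Λ

end DualOperations

/-! ### Operations on `L¹(G/H)` and the final embedding -/

section L1

variable {G : Type*} [Group G] [TopologicalSpace G] [IsTopologicalGroup G] [LocallyCompactSpace G]
  [T2Space G] [MeasurableSpace G] [BorelSpace G] {H : Subgroup G} [CompactSpace H]
  {σ : Measure G} [σ.IsHaarMeasure] [σ.Regular] {μ : Measure (CosetSpace H)} [μ.Regular]

omit [LocallyCompactSpace G] [T2Space G] [MeasurableSpace G] [BorelSpace G] [CompactSpace H] in
theorem exists_coeFn_ae_eq (F : C_c(CosetSpace H, ℂ)) : ∃ φ : Lp ℂ 1 μ, φ =ᵐ[μ] F :=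
  have hi : Integrable F μ := F.continuous.integrable_of_hasCompactSupport F.hasCompactSupport
  ⟨hi.toL1 F, hi.coeFn_toL1⟩

variable (μ) in
theorem isClosed_range_densityIsometry : IsClosed (Set.range (densityIsometry μ)) :=
  (densityIsometry μ).isometry.isUniformInducing.isComplete_range.isClosed

/-- The range of `L¹` is closed and convolution is continuous, so it suffices to treat `C_c(G/H)`:
first in the left factor, then in the right one. -/
theorem exists_densityDual_eq_cosetConv (hμ : WeilFormula H σ μ) (φ₁ φ₂ : Lp ℂ 1 μ) :
    ∃ φ : Lp ℂ 1 μ, densityDual μ φ = cosetConv H (densityDual μ φ₁) (densityDual μ φ₂) := by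
  have hJ := (densityIsometry μ).continuous
  have h1 : ∀ φ₂ ∈ {φ : Lp ℂ 1 μ | ∃ f : C_c(CosetSpace H, ℂ), φ =ᵐ[μ] f}, ∀ φ₁ : Lp ℂ 1 μ,
      cosetConvCLM H (densityIsometry μ φ₁) (densityIsometry μ φ₂) ∈
        Set.range (densityIsometry μ) := by
    rintro φ₂ ⟨F₂, h₂⟩ φ₁
    refine ((isClosed_range_densityIsometry μ).preimage (((cosetConvCLM H).flip
      (densityIsometry μ φ₂)).continuous.comp hJ)).closure_subset_iff.2 ?_
      (dense_compactSupport μ φ₁)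
    rintro φ₁ ⟨F₁, h₁⟩
    obtain ⟨F, hF⟩ := exists_eq_convFun hμ F₁ F₂
    obtain ⟨φ, h⟩ := exists_coeFn_ae_eq (μ := μ) F
    exact ⟨φ, (cosetConv_densityDual hμ h₁ h₂ (hF ▸ h)).symm⟩
  exact ((isClosed_range_densityIsometry μ).preimage ((cosetConvCLM H
    (densityIsometry μ φ₁)).continuous.comp hJ)).closure_subset_iff.2
    (fun φ₂ h₂ => h1 φ₂ h₂ φ₁) (dense_compactSupport μ φ₂)

theorem exists_densityDual_eq_cosetStar (hμ : WeilFormula H σ μ) (φ₁ : Lp ℂ 1 μ) :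
    ∃ φ : Lp ℂ 1 μ, densityDual μ φ = cosetStar H (densityDual μ φ₁) := by
  refine ((isClosed_range_densityIsometry μ).preimage ((cosetStarCLM H).continuous.comp
    (densityIsometry μ).continuous)).closure_subset_iff.2 ?_ (dense_compactSupport μ φ₁)
  rintro φ₁ ⟨F₁, h₁⟩
  obtain ⟨F, hF⟩ := exists_eq_invFun σ F₁
  obtain ⟨φ, h⟩ := exists_coeFn_ae_eq (μ := μ) F
  exact ⟨φ, (cosetStar_densityDual hμ h₁ (hF ▸ h)).symm⟩

theorem densityDual_injective : Function.Injective (densityDual μ) :=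
  (densityIsometry μ).injective

/-- The convolution of `C_c(G/H)` extends to `L¹(G/H)`. -/
theorem exists_isConvExtension (hμ : WeilFormula H σ μ) :
    ∃ B : Lp ℂ 1 μ →L[ℂ] Lp ℂ 1 μ →L[ℂ] Lp ℂ 1 μ, IsConvExtension H μ B ∧ ∀ φ₁ φ₂,
      densityDual μ (B φ₁ φ₂) = cosetConv H (densityDual μ φ₁) (densityDual μ φ₂) := by
  -- The product is chosen pair by pair; injectivity of `densityDual` then forces bilinearity.
  choose b hb using exists_densityDual_eq_cosetConv hμ
  have hinj := densityDual_injective (μ := μ)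
  let B : Lp ℂ 1 μ →L[ℂ] Lp ℂ 1 μ →L[ℂ] Lp ℂ 1 μ := LinearMap.mkContinuous₂
    (LinearMap.mk₂ ℂ b
      (fun φ₁ φ₂ φ => hinj (by
        rw [densityDual_add, hb, hb, hb, densityDual_add, cosetConv_add_left]))
      (fun c φ₁ φ => hinj (by
        rw [densityDual_smul, hb, hb, densityDual_smul, cosetConv_smul_left]))
      (fun φ φ₁ φ₂ => hinj (by
        rw [densityDual_add, hb, hb, hb, densityDual_add]
        rfl))
      (fun c φ φ₁ => hinj (by
        rw [densityDual_smul, hb, hb, densityDual_smul]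
        rfl))) 1 fun φ₁ φ₂ => by
    rw [one_mul, ← norm_densityDual, ← norm_densityDual μ φ₁, ← norm_densityDual μ φ₂]
    exact (congrArg norm (hb φ₁ φ₂)).trans_le (norm_cosetConv_le H _ _)
  refine ⟨B, fun F₁ F₂ φ₁ φ₂ h₁ h₂ => ?_, hb⟩
  obtain ⟨F, hF⟩ := exists_eq_convFun hμ F₁ F₂
  obtain ⟨φ, h⟩ := exists_coeFn_ae_eq (μ := μ) F
  have h3 : B φ₁ φ₂ = φ :=
    hinj ((hb φ₁ φ₂).trans (cosetConv_densityDual hμ h₁ h₂ (hF ▸ h)))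
  rw [h3, ← hF]
  exact h

theorem IsConvExtension.unique
    {B B' : Lp ℂ 1 μ →L[ℂ] Lp ℂ 1 μ →L[ℂ] Lp ℂ 1 μ}
    (h : IsConvExtension H μ B) (h' : IsConvExtension H μ B') : B = B' := by
  refine ContinuousLinearMap.coeFn_injective (Continuous.ext_on (dense_compactSupport μ)
    B.continuous B'.continuous ?_)
  rintro φ₁ ⟨F₁, h₁⟩
  refine ContinuousLinearMap.coeFn_injective (Continuous.ext_on (dense_compactSupport μ)
    (B φ₁).continuous (B' φ₁).continuous ?_)
  rintro φ₂ ⟨F₂, h₂⟩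
  exact Lp.ext ((h F₁ F₂ φ₁ φ₂ h₁ h₂).trans (h' F₁ F₂ φ₁ φ₂ h₁ h₂).symm)

theorem existsUnique_isConvExtension (hμ : WeilFormula H σ μ) :
    ∃! B : Lp ℂ 1 μ →L[ℂ] Lp ℂ 1 μ →L[ℂ] Lp ℂ 1 μ, IsConvExtension H μ B :=
  let ⟨B, hB, _⟩ := exists_isConvExtension hμ
  ⟨B, hB, fun _ h => h.unique hB⟩

theorem densityDual_l1Conv (hμ : WeilFormula H σ μ) (φ₁ φ₂ : Lp ℂ 1 μ) :
    densityDual μ (l1Conv H μ φ₁ φ₂) = cosetConv H (densityDual μ φ₁) (densityDual μ φ₂) := by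
  obtain ⟨B, hB, h⟩ := exists_isConvExtension hμ
  have he : ∃ B, IsConvExtension H μ B := ⟨B, hB⟩
  rw [l1Conv, dif_pos he, he.choose_spec.unique hB, h]

/-- The involution of `C_c(G/H)` extends to `L¹(G/H)`. -/
theorem exists_isInvExtension (hμ : WeilFormula H σ μ) :
    ∃ S : Lp ℂ 1 μ →L⋆[ℂ] Lp ℂ 1 μ, IsInvExtension H μ S ∧ ∀ φ,
      densityDual μ (S φ) = cosetStar H (densityDual μ φ) := by
  choose s hs using exists_densityDual_eq_cosetStar hμ
  have hinj := densityDual_injective (μ := μ)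
  let S : Lp ℂ 1 μ →L⋆[ℂ] Lp ℂ 1 μ := LinearMap.mkContinuous
    { toFun := s
      map_add' := fun φ₁ φ₂ => hinj (by
        rw [densityDual_add, hs, hs, hs, densityDual_add, cosetStar_add])
      map_smul' := fun c φ => hinj (by
        rw [densityDual_smul, hs, hs, densityDual_smul, cosetStar_smul]) } 1 fun φ => by
    rw [one_mul, ← norm_densityDual, ← norm_densityDual μ φ]
    exact (congrArg norm (hs φ)).trans_le (norm_cosetStar_le H _)
  refine ⟨S, fun F φ h => ?_, hs⟩
  obtain ⟨F', hF'⟩ := exists_eq_invFun σ F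
  obtain ⟨φ', h'⟩ := exists_coeFn_ae_eq (μ := μ) F'
  have h3 : S φ = φ' := hinj ((hs φ).trans (cosetStar_densityDual hμ h (hF' ▸ h')))
  rw [h3, ← hF']
  exact h'

theorem IsInvExtension.unique
    {S S' : Lp ℂ 1 μ →L⋆[ℂ] Lp ℂ 1 μ}
    (h : IsInvExtension H μ S) (h' : IsInvExtension H μ S') : S = S' := by
  refine ContinuousLinearMap.coeFn_injective (Continuous.ext_on (dense_compactSupport μ)
    S.continuous S'.continuous ?_)
  rintro φ ⟨F, hF⟩
  exact Lp.ext ((h F φ hF).trans (h' F φ hF).symm)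

theorem existsUnique_isInvExtension (hμ : WeilFormula H σ μ) :
    ∃! S : Lp ℂ 1 μ →L⋆[ℂ] Lp ℂ 1 μ, IsInvExtension H μ S :=
  let ⟨S, hS, _⟩ := exists_isInvExtension hμ
  ⟨S, hS, fun _ h => h.unique hS⟩

theorem densityDual_l1Inv (hμ : WeilFormula H σ μ) (φ : Lp ℂ 1 μ) :
    densityDual μ (l1Inv H μ φ) = cosetStar H (densityDual μ φ) := by
  obtain ⟨S, hS, h⟩ := exists_isInvExtension hμ
  have he : ∃ S, IsInvExtension H μ S := ⟨S, hS⟩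
  rw [l1Inv, dif_pos he, he.choose_spec.unique hS, h]

/-- By invariance of `μ`, translating the density is translating the functional; injectivity of
`densityDual` recovers equality almost everywhere. -/
theorem mem_A1_iff [SMulInvariantMeasure G (CosetSpace H) μ] {φ : Lp ℂ 1 μ} :
    φ ∈ A1 H μ ↔ IsInvariant H (densityDual μ φ) := by
  have hi : ∀ g : G, Integrable (fun x => φ (g⁻¹ • x)) μ := fun g =>
    (measurePreserving_smul g⁻¹ μ).integrable_comp_of_integrable (L1.integrable_coeFn φ)
  have h1 : ∀ (g : G) (ψ : C₀(CosetSpace H, ℂ)), densityDual μ ((hi g).toL1 _) ψ =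
      densityDual μ φ (leftTranslate g ψ) := fun g ψ => by
    rw [densityDual_apply_of_ae μ (hi g).coeFn_toL1, densityDual_apply,
      ← integral_smul_eq_self (μ := μ) (fun x => ψ x * φ (g⁻¹ • x)) (g := g)]
    simp only [inv_smul_smul, leftTranslate_apply]
  have h2 : ∀ g : G, (fun x => φ (g⁻¹ • x)) =ᵐ[μ] φ ↔ densityDual μ ((hi g).toL1 _) =
      densityDual μ φ := fun g => by
    rw [densityDual_injective.eq_iff]
    constructor
    · intro h
      exact Lp.ext ((hi g).coeFn_toL1.trans h)
    · intro h
      have h3 := (hi g).coeFn_toL1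
      rw [h] at h3
      exact h3.symm
  rw [isInvariant_iff]
  refine forall₂_congr fun g _ => (h2 g).trans ?_
  rw [ContinuousLinearMap.ext_iff]
  exact forall_congr' fun ψ => by rw [h1]

theorem dual_densityMeasure (φ : Lp ℂ 1 μ) :
    densityMeasure μ φ ∈ regularMeasures (CosetSpace H) ∧
      dual (densityMeasure μ φ) = densityDual μ φ :=
  rieszMeasure_spec (densityDual μ φ)

theorem isIsometricStarEmbedding_densityMeasure [SMulInvariantMeasure G (CosetSpace H) μ]
    (hμ : WeilFormula H σ μ) :
    IsIsometricStarEmbedding (A1 H μ) (fun φ => ‖φ‖) (l1Conv H μ) (l1Inv H μ)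
      (invariantMeasures H) tvNorm (measConv H) (measInv H) (densityMeasure μ) where
  mapsTo φ hφ := mem_invariantMeasures_iff.2 ⟨(dual_densityMeasure φ).1, by
    rw [(dual_densityMeasure φ).2]
    exact mem_A1_iff.1 hφ⟩
  injOn φ _ φ' _ h := densityDual_injective (by
    rw [← (dual_densityMeasure φ).2, h, (dual_densityMeasure φ').2])
  map_add φ _ φ' _ := dual_injOn (dual_densityMeasure _).1
    (regular_add (dual_densityMeasure φ).1 (dual_densityMeasure φ').1) (by
      rw [dual_add, (dual_densityMeasure _).2, (dual_densityMeasure _).2,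
        (dual_densityMeasure _).2, densityDual_add])
  map_smul c φ _ := dual_injOn (dual_densityMeasure _).1
    (regular_smul c (dual_densityMeasure φ).1) (by
      rw [dual_smul, (dual_densityMeasure _).2, (dual_densityMeasure _).2, densityDual_smul])
  map_mul φ _ φ' _ := dual_injOn (dual_densityMeasure _).1 (dual_measConv _ _).1 (by
    rw [(dual_measConv _ _).2, (dual_densityMeasure _).2, (dual_densityMeasure _).2,
      (dual_densityMeasure _).2, densityDual_l1Conv hμ])
  map_inv φ _ := dual_injOn (dual_densityMeasure _).1 (dual_measInv _).1 (by
    rw [(dual_measInv _).2, (dual_densityMeasure _).2, (dual_densityMeasure _).2,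
      densityDual_l1Inv hμ])
  map_norm φ _ := by
    rw [← norm_dual (dual_densityMeasure φ).1, (dual_densityMeasure φ).2, norm_densityDual]

theorem isBanachStarAlgebra_A1 [SMulInvariantMeasure G (CosetSpace H) μ]
    (hμ : WeilFormula H σ μ) :
    IsBanachStarAlgebra (A1 H μ) (fun φ => ‖φ‖) (l1Conv H μ) (l1Inv H μ) := by
  refine (isIsometricStarEmbedding_densityMeasure hμ).isBanachStarAlgebra
    isBanachStarAlgebra_invariantMeasures (fun h _ => ?_) (fun φ hφ φ' hφ' => ?_)
    (fun c φ hφ => ?_) (fun φ hφ φ' _ => ?_) (fun φ hφ => ?_) fun u κ _ hκ hlim => ?_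
  · have h0 := Lp.coeFn_zero ℂ 1 μ
    have h1 := (measurePreserving_smul h⁻¹ μ).quasiMeasurePreserving.ae_eq_comp h0
    exact h1.trans h0.symm
  · rw [mem_A1_iff] at *
    rw [densityDual_add]
    exact isInvariant_add hφ hφ'
  · rw [mem_A1_iff] at *
    rw [densityDual_smul]
    exact isInvariant_smul c hφ
  · rw [mem_A1_iff] at *
    rw [densityDual_l1Conv hμ]
    exact isInvariant_cosetConv hφ
  · rw [mem_A1_iff] at *
    rw [densityDual_l1Inv hμ]
    exact isInvariant_cosetStar hφ
  -- Convergence in total variation is norm convergence in the dual, so the limit stays in the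
  -- closed range and has an `L¹` density.
  · have h1 : Tendsto (fun n => densityIsometry μ (u n)) atTop (𝓝 (dual κ)) := by
      refine tendsto_iff_norm_sub_tendsto_zero.2 (hlim.congr fun n => ?_)
      have h2 : densityMeasure μ (u n) - κ = densityMeasure μ (u n) + (-1 : ℂ) • κ := by
        ext E _
        change densityMeasure μ (u n) E - κ E = densityMeasure μ (u n) E + -1 * κ E
        ring
      have h3 : densityDual μ (u n) + (-1 : ℂ) • dual κ = densityDual μ (u n) - dual κ := by
        ext ψ
        change densityDual μ (u n) ψ + -1 * dual κ ψ = densityDual μ (u n) ψ - dual κ ψ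
        ring
      rw [h2, ← norm_dual (regular_add (dual_densityMeasure _).1 (regular_smul _ hκ.1)), dual_add,
        dual_smul, (dual_densityMeasure _).2, h3]
      rfl
    obtain ⟨φ, hφ⟩ := (isClosed_range_densityIsometry μ).mem_of_tendsto h1
      (Eventually.of_forall fun n => ⟨u n, rfl⟩)
    have hφ' : densityDual μ φ = dual κ := hφ
    refine ⟨φ, mem_A1_iff.2 ?_, dual_injOn (dual_densityMeasure φ).1 hκ.1 ?_⟩
    · rw [hφ']
      exact (mem_invariantMeasures_iff.1 hκ).2
    · rw [(dual_densityMeasure φ).2, hφ']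

end L1

end CosetAlgebra

end

theorem mainTheorem6 {G : Type*} [Group G] [TopologicalSpace G] [IsTopologicalGroup G]
    [LocallyCompactSpace G] [T2Space G] [MeasurableSpace G] [BorelSpace G]
    (H : Subgroup G) [CompactSpace H]
    (σ : Measure G) [σ.IsHaarMeasure] [σ.Regular]
    (μ : Measure (CosetSpace H)) [μ.Regular] [SMulInvariantMeasure G (CosetSpace H) μ]
    (hμ : WeilFormula H σ μ) :
    -- the operations are well defined
    (∃! B : Lp ℂ 1 μ →L[ℂ] Lp ℂ 1 μ →L[ℂ] Lp ℂ 1 μ, IsConvExtension H μ B) ∧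
    (∃! S : Lp ℂ 1 μ →L⋆[ℂ] Lp ℂ 1 μ, IsInvExtension H μ S) ∧
    (∀ κ ∈ regularMeasures (CosetSpace H), ∀ κ' ∈ regularMeasures (CosetSpace H),
      ∃! ρ : ComplexMeasure (CosetSpace H), Represents (convFunctional H κ κ') ρ) ∧
    (∀ κ ∈ regularMeasures (CosetSpace H),
      ∃! ρ : ComplexMeasure (CosetSpace H), Represents (invFunctional H κ) ρ) ∧
    (∀ φ : Lp ℂ 1 μ, ∃! ρ : ComplexMeasure (CosetSpace H),
      Represents (densityFunctional μ φ) ρ) ∧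
    -- both sides are Banach `*`-algebras
    IsBanachStarAlgebra (A1 H μ) (fun φ => ‖φ‖) (l1Conv H μ) (l1Inv H μ) ∧
    IsBanachStarAlgebra (invariantMeasures H) tvNorm (measConv H) (measInv H) ∧
    -- `φ ↦ μ_φ` is an isometric `*`-homomorphic embedding
    IsIsometricStarEmbedding (A1 H μ) (fun φ => ‖φ‖) (l1Conv H μ) (l1Inv H μ)
      (invariantMeasures H) tvNorm (measConv H) (measInv H) (densityMeasure μ) := by
  refine ⟨existsUnique_isConvExtension hμ, existsUnique_isInvExtension hμ,
    fun κ _ κ' _ => ?_, fun κ _ => ?_, fun φ => existsUnique_represents (densityDual μ φ),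
    isBanachStarAlgebra_A1 hμ, isBanachStarAlgebra_invariantMeasures,
    isIsometricStarEmbedding_densityMeasure hμ⟩
  · rw [convFunctional_eq]
    exact existsUnique_represents _
  · rw [invFunctional_eq]
    exact existsUnique_represents _
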